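/- Let $A=\mathbb{C}[h]$, $Z=\mathrm{Spec}(A)$, $z_0=(h)\in Z$ and $Z_*=Z\setminus\{z_0\}$. A rooted tree $\Gamma$ is a finite nonempty poset with a unique minimal element $e_0$ (the root) in which every set $\{e'\le e\}$ is a chain. Its maximal elements are the leaves; the other nodes are called parents and form the set $\mathbf{P}(\Gamma)$. For $e\ne e_0$, $\mathrm{Par}(e)$ is the largest node $<e$; the children of a node are the minimal nodes above it. A fine-labelled rooted tree is a pair $\mathfrak g=(\Gamma,lb)$ with a function $lb$ from the nodes $\neq e_0$ to $\mathbb{C}$ such that $lb(f)\ne lb(f')$ whenever $f\neq f'$ are children of the same node. Let $A[\Gamma]$ be the polynomial ring over $A$ in the variables $X_0$ and $X_e$, $e\in\mathbf{P}(\Gamma)$, and put $X_{\mathrm{Par}(e_0)}:=X_0$. For a node $e$ and a set $J$ of children of $e$, let $S_e^J=\prod_{f}(X_{\mathrm{Par}(e)}-lb(f))$, over the children $f\notin J$ of $e$. Let $R_{e_0}=1$, $R_e=S_{\mathrm{Par}(e)}^{\{e\}}R_{\mathrm{Par}(e)}$ for $e\ne e_0$, and $Q_e=S_e^{\emptyset}R_e$.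 Let $M(\mathfrak g)$ be the matrix with columns $M_0=\binom{h}{1}$ and $M_e=\binom{Q_e}{X_e}$, $e\in\mathbf{P}(\Gamma)$. Let $I_{\mathfrak g}\subset A[\Gamma]$ be the ideal generated by $\Delta_{0,e}=\det(M_0,M_e)$, $e\in\mathbf{P}(\Gamma)$, and by the simplified minors $\Delta_{e',e}=R_{e''}^{-1}\det(M_{e'},M_e)\in A[\Gamma]$, for $e',e\in\mathbf{P}(\Gamma)$ with $e'<e$, where $e''$ is the child of $e'$ with $e''\le e$. Put $B_{\mathfrak g}=A[\Gamma]/I_{\mathfrak g}$, $V_{\mathfrak g}=\mathrm{Spec}(B_{\mathfrak g})$, and let $q_{\mathfrak g}:V_{\mathfrak g}\to Z$ be induced by $A\to B_{\mathfrak g}$. A generalized Danielewski surface (GDS) over $Z$ is a normal affine surface $V$ over $\mathbb{C}$ (integral, of finite type, of dimension $2$) with a faithfully flat morphism $q:V\to Z$ with reduced fibers and with generic fiber isomorphic to $\mathbb{A}^1_{K(Z)}$ over $K(Z)$, such that all closed fibers of $q$ except possibly one are integral. **Theorem.** For every fine-labelled rooted tree $\mathfrak g$: 1. $q_{\mathfrak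 g}:V_{\mathfrak g}\to Z$ is a GDS over $Z$ (in particular $q_{\mathfrak g}$ is flat and all its fibers are nonempty and reduced); 2. $q_{\mathfrak g}$ restricts to a trivial line bundle over $Z_*$, that is, $q_{\mathfrak g}^{-1}(Z_*)\simeq\mathbb{A}^1_{Z_*}$ over $Z_*$; 3. for each leaf $e$ let $C_e\subset V_{\mathfrak g}$ be the closed subscheme defined by the ideal of $A[\Gamma]$ generated by $I_{\mathfrak g}$, $h$ and the polynomials $X_{\mathrm{Par}(\mathrm{Par}(f))}-lb(f)$, for all nodes $f$ with $e_0<f\le e$. Then the scheme-theoretic fiber $q_{\mathfrak g}^{-1}(z_0)$ is the disjoint union of the curves $C_e$, $e$ a leaf, and $C_e\simeq\mathrm{Spec}(\mathbb{C}[X_{\mathrm{Par}(e)}])$ is an affine line with coordinate $X_{\mathrm{Par}(e)}$; 4. $V_{\mathfrak g}$ is nonsingular, i.e. all its local rings are regular. -/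

import Mathlib

open CategoryTheory CategoryTheory.Limits AlgebraicGeometry
open scoped Polynomial

noncomputable section

namespace GDS

/-! ## Generalized Danielewski surfaces over the affine line -/

/-- The affine line `Z = Spec ℂ[h]`. The polynomial variable `Polynomial.X` plays the role of
`h`. -/
abbrev Z : Scheme.{0} := Spec (CommRingCat.of ℂ[X])

/-- The origin `z₀ = (h)` of the affine line. -/
def z₀ : Z :=
  (⟨Ideal.span {(Polynomial.X : ℂ[X])},
    (Ideal.span_singleton_prime Polynomial.X_ne_zero).2 Polynomial.prime_X⟩ :
    PrimeSpectrum ℂ[X])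

/-- The punctured line `Z \ {z₀}`, i.e. the principal open subset `h ≠ 0`. -/
def Zstar : Z.Opens := PrimeSpectrum.basicOpen (Polynomial.X : ℂ[X])

theorem mem_Zstar_iff (z : Z) : z ∈ Zstar ↔ z ≠ z₀ := by
  have hmax : (Ideal.span {(Polynomial.X : ℂ[X])}).IsMaximal :=
    PrincipalIdealRing.isMaximal_of_irreducible Polynomial.irreducible_X
  constructor
  · rintro hz rfl
    exact hz (Ideal.subset_span rfl)
  · intro hz hX
    refine hz (PrimeSpectrum.ext ?_)
    exact (hmax.eq_of_le (PrimeSpectrum.isPrime _).ne_top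
      ((Ideal.span_singleton_le_iff_mem _).2 hX)).symm

/-- A morphism `q : V ⟶ Z` makes `V` a generalized Danielewski surface: `V` is a normal affine
surface over `ℂ` and `q` is faithfully flat with reduced fibers, with generic fiber the affine
line over `K(Z)`, and all closed fibers of `q` but possibly one are integral. (Since `Z` is of
finite type over `ℂ`, the scheme `V` is of finite type over `ℂ` if and only if `q` is locally of
finite type, `V` being affine.) -/
structure IsGDS {V : Scheme.{0}} (q : V ⟶ Z) : Prop where
  isAffine : IsAffine V
  locallyOfFiniteType : LocallyOfFiniteType q
  isIntegral : IsIntegral V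
  dim_eq_two : topologicalKrullDim V = 2
  normal : ∀ x : V, IsIntegrallyClosed (V.presheaf.stalk x)
  flat : Flat q
  surjective : Surjective q
  reduced_fiber : ∀ z : Z, IsReduced (q.fiber z)
  generic_fiber :
    ∃ i : q.fiber (genericPoint Z) ≅ 𝔸(PUnit; Spec (Z.residueField (genericPoint Z))),
      i.hom ≫ (𝔸(PUnit; Spec (Z.residueField (genericPoint Z))) ↘
        Spec (Z.residueField (genericPoint Z))) = q.fiberToSpecResidueField (genericPoint Z)
  integral_fiber : ∃ z₁ : Z, IsClosed {z₁} ∧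
    ∀ z : Z, IsClosed {z} → z ≠ z₁ → IsIntegral (q.fiber z)

/-- `q` restricts over the open subset `U` of `Z` to a trivial line bundle. -/
def IsTrivialLineBundleOver {V : Scheme.{0}} (q : V ⟶ Z) (U : Z.Opens) : Prop :=
  ∃ i : (q ⁻¹ᵁ U).toScheme ≅ 𝔸(PUnit; U.toScheme),
    i.hom ≫ (𝔸(PUnit; U.toScheme) ↘ U.toScheme) = q ∣_ U

/-- `V` is nonsingular: all its local rings are regular. -/
def IsNonsingular (V : Scheme.{0}) : Prop :=
  ∀ x : V, IsRegularLocalRing (V.presheaf.stalk x)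

/-! ## Labelled rooted trees

A finite rooted tree is Mathlib's `RootedTree` with finitely many nodes: the root is `⊥`, the
parent of a node `e ≠ ⊥` is `Order.pred e`, the children of `e` are the nodes covering `e`, the
ancestors of `e` are the nodes `e' < e`, and the leaves are the maximal nodes. -/

variable (T : RootedTree.{0})

/-- The parents of the tree, i.e. the nodes that are not leaves. -/
abbrev Parents : Type := {e : T // ¬ IsMax e}

/-- The leaves of the tree. -/
abbrev Leaves : Type := {e : T // IsMax e}

variable {T}

/-- A labelling of the nodes other than the root. It is given by a function on all nodes, whose
value at the root is never used. It is fine if different children of a node have different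
labels. -/
def IsFine (lb : T → ℂ) : Prop :=
  ∀ e f f' : T, e ⋖ f → e ⋖ f' → f ≠ f' → lb f ≠ lb f'

variable (T)

/-- The polynomial ring `A[Γ]` over `A = ℂ[h]` in the variable `X₀` (index `none`) and the
variables `X_e` indexed by the parents `e` (index `some e`). -/
abbrev Amb : Type := MvPolynomial (Option (Parents T)) ℂ[X]

variable {T}

/-- The element `h` of `A[Γ]`. -/
def hVar : Amb T := MvPolynomial.C Polynomial.X

/-- The constant `c ∈ ℂ` in `A[Γ]`. -/
def const (c : ℂ) : Amb T := MvPolynomial.C (Polynomial.C c)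

theorem pred_not_isMax {e : T} (h : e ≠ ⊥) : ¬ IsMax (Order.pred e) := fun hm =>
  hm.not_lt (Order.pred_lt_of_not_isMin fun hmin => h hmin.eq_bot)

open Classical in
/-- The variable `X_{Par(e)}`, with the convention `X_{Par(⊥)} = X₀`. -/
def xPar (e : T) : Amb T :=
  if h : e = ⊥ then MvPolynomial.X none
  else MvPolynomial.X (some ⟨Order.pred e, pred_not_isMax h⟩)

variable [Fintype T] (lb : T → ℂ)

open Classical in
/-- `S_e^J`, the product of `X_{Par(e)} - lb(f)` over the children `f` of `e` outside `J`. -/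
def sibPoly (e : T) (J : Set T) : Amb T :=
  ∏ f ∈ Finset.univ.filter (fun f : T => e ⋖ f ∧ f ∉ J), (xPar e - const (lb f))

open Classical in
/-- The root polynomial `R_e`. -/
def rootPoly (e : T) : Amb T :=
  if h : e = ⊥ then 1
  else sibPoly lb (Order.pred e) {e} * rootPoly (Order.pred e)
termination_by wellFounded_lt.wrap e
decreasing_by exact Order.pred_lt_of_not_isMin fun hmin => h hmin.eq_bot

/-- `Q_e = S_e R_e`. -/
def qPoly (e : T) : Amb T := sibPoly lb e ∅ * rootPoly lb e

/-- The matrix `M(𝔤)` with the columns `(h, 1)` and `(Q_e, X_e)`, for `e` a parent. -/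
def matM : Matrix (Fin 2) (Option (Parents T)) (Amb T) :=
  Matrix.of ![fun i => i.elim hVar (fun e => qPoly lb e.1),
    fun i => i.elim 1 (fun e => MvPolynomial.X (some e))]

/-- The minor of `M(𝔤)` on the columns `i`, `j`, in this order. -/
def minor (i j : Option (Parents T)) : Amb T := ((matM lb).submatrix id ![i, j]).det

/-- `d` is the simplified minor `Δ_{e',e} = R_{e''}⁻¹ det(M_{e'}, M_e)`, where `e'` is an ancestor
of the parent `e` and `e''` is the child of `e'` in the chain of nodes below `e`. -/
def IsSimplifiedMinor (e' e : Parents T) (d : Amb T) : Prop :=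
  ∃ e'' : T, e'.1 ⋖ e'' ∧ e'' ≤ e.1 ∧ rootPoly lb e'' * d = minor lb (some e') (some e)

/-- The ideal `I_𝔤` generated by the minors `Δ_{0,e} = det(M_0, M_e)` and the simplified minors
`Δ_{e',e}`, for `e'` an ancestor of `e`. -/
def idealI : Ideal (Amb T) :=
  Ideal.span ({d | ∃ e : Parents T, d = minor lb none (some e)} ∪
    {d | ∃ e' e : Parents T, e'.1 < e.1 ∧ IsSimplifiedMinor lb e' e d})

/-- The algebra `B_𝔤 = A[Γ] / I_𝔤`. -/
abbrev B : Type := Amb T ⧸ idealI lb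

/-- The affine scheme `V_𝔤 = Spec B_𝔤`. -/
abbrev V : Scheme.{0} := Spec (CommRingCat.of (B lb))

/-- The morphism `q_𝔤 : V_𝔤 ⟶ Z` induced by the structure map `A → B_𝔤`. -/
def q : V lb ⟶ Z := Spec.map (CommRingCat.ofHom (algebraMap ℂ[X] (B lb)))

/-- The ideal of `A[Γ]` defining the curve `C_e`, for a leaf `e`. It is generated by `I_𝔤`, by `h`
and by the polynomials `X_{Par(Par(f))} - lb(f)`, where `f` runs through the nodes other than the
root in the chain of nodes below `e`. -/
def leafIdeal (e : Leaves T) : Ideal (Amb T) :=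
  idealI lb ⊔ Ideal.span
    ({hVar} ∪ {d | ∃ f : T, f ≠ ⊥ ∧ f ≤ e.1 ∧ d = xPar (Order.pred f) - const (lb f)})

/-- The curve `C_e`, for a leaf `e`. -/
abbrev leafCurve (e : Leaves T) : Scheme.{0} := Spec (CommRingCat.of (Amb T ⧸ leafIdeal lb e))

/-- The closed embedding of `C_e` into `V_𝔤`. -/
def leafCurveι (e : Leaves T) : leafCurve lb e ⟶ V lb :=
  Spec.map (CommRingCat.ofHom
    (Ideal.Quotient.factor (le_sup_left : idealI lb ≤ leafIdeal lb e)))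

/-- The homomorphism `ℂ[t] → A[Γ] / I_𝔤(e)`, `t ↦ X_{Par(e)}`, from the coordinate ring of the
affine line to the coordinate ring of `C_e`. -/
def leafCoord (e : Leaves T) : ℂ[X] →ₐ[ℂ] (Amb T ⧸ leafIdeal lb e) :=
  Polynomial.aeval (Ideal.Quotient.mk (leafIdeal lb e) (xPar e.1))

/-! ## The simplified minors exist and are unique -/

set_option linter.unusedSectionVars false

theorem xPar_sub_const_ne_zero (e : T) (c : ℂ) : (xPar e - const c : Amb T) ≠ 0 := by
  have key (i : Option (Parents T)) : (MvPolynomial.X i - const c : Amb T) ≠ 0 := by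
    intro h
    have h1 := congrArg (MvPolynomial.eval fun _ => (Polynomial.C (c + 1) : ℂ[X])) h
    simp [const] at h1
  unfold xPar
  split_ifs
  · exact key _
  · exact key _

theorem rootPoly_bot : rootPoly lb (⊥ : T) = 1 := by
  rw [rootPoly]; simp

theorem rootPoly_of_ne_bot {e : T} (h : e ≠ ⊥) :
    rootPoly lb e = sibPoly lb (Order.pred e) {e} * rootPoly lb (Order.pred e) := by
  rw [rootPoly]; simp [h]

theorem rootPoly_ne_zero (e : T) : rootPoly lb e ≠ 0 := by
  induction e using WellFoundedLT.induction with
  | ind e ih =>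
    by_cases h : e = ⊥
    · subst h; simp [rootPoly_bot]
    · rw [rootPoly_of_ne_bot lb h]
      refine mul_ne_zero ?_
        (ih _ (Order.pred_lt_of_not_isMin fun hmin => h hmin.eq_bot))
      exact Finset.prod_ne_zero_iff.2 fun f _ => xPar_sub_const_ne_zero _ _

theorem rootPoly_dvd {c : T} (e : T) (hc : c ≤ e) : rootPoly lb c ∣ rootPoly lb e := by
  induction e using WellFoundedLT.induction with
  | ind e ih =>
    rcases hc.eq_or_lt with rfl | hlt
    · exact dvd_rfl
    · have h : e ≠ ⊥ := fun h => not_lt_bot (h ▸ hlt)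
      rw [rootPoly_of_ne_bot lb h]
      exact Dvd.dvd.mul_left (ih _ (Order.pred_lt_of_not_isMin fun hmin => h hmin.eq_bot)
        (Order.le_pred_of_lt hlt)) _

theorem minor_some_some (e' e : Parents T) : minor lb (some e') (some e) =
    qPoly lb e'.1 * MvPolynomial.X (some e) - qPoly lb e.1 * MvPolynomial.X (some e') := by
  simp [minor, matM, Matrix.det_fin_two]

theorem pred_eq_of_covBy {e f : T} (h : e ⋖ f) : Order.pred f = e := by
  have hle : e ≤ Order.pred f := Order.le_pred_of_lt h.lt
  have hlt : Order.pred f < f :=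
    Order.pred_lt_of_not_isMin fun hmin => hmin.not_lt h.lt
  exact (h.eq_or_eq hle hlt.le).resolve_right hlt.ne

theorem existsUnique_isSimplifiedMinor (e' e : Parents T) (hlt : e'.1 < e.1) :
    ∃! d, IsSimplifiedMinor lb e' e d := by
  classical
  obtain ⟨c, hc, hce⟩ := exists_covBy_le_of_lt hlt
  have hc0 : c ≠ ⊥ := fun h => not_lt_bot (h ▸ hc.lt)
  have hdvd : rootPoly lb c ∣ minor lb (some e') (some e) := by
    rw [minor_some_some]
    refine dvd_sub (Dvd.dvd.mul_right ?_ _) (Dvd.dvd.mul_right ?_ _)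
    · rw [rootPoly_of_ne_bot lb hc0, pred_eq_of_covBy hc, qPoly]
      refine mul_dvd_mul ?_ dvd_rfl
      refine Finset.prod_dvd_prod_of_subset _ _ _ fun f hf => ?_
      simp only [Finset.mem_filter] at hf ⊢
      exact ⟨hf.1, hf.2.1, fun h => h⟩
    · exact (rootPoly_dvd lb _ hce).mul_left _
  obtain ⟨d, hd⟩ := hdvd
  refine ⟨d, ⟨c, hc, hce, hd.symm⟩, ?_⟩
  rintro d' ⟨c', hc', hce', hd'⟩
  have hcc : c' = c := by
    rcases le_total_of_directed hce hce' with h | h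
    · exact (hc.eq_or_eq hc'.le h).resolve_left hc'.lt.ne'
    · exact ((hc'.eq_or_eq hc.le h).resolve_left hc.lt.ne').symm
  subst hcc
  exact mul_left_cancel₀ (rootPoly_ne_zero lb c') (hd'.trans hd)

end GDS

end

/-! The equations `h X_e = Q_e` are triangular: `Q_e` involves only `X₀` and the variables of the
ancestors of `e`. Once `h` is inverted, every `X_e` is therefore a polynomial in `X₀`, which gives
`B[1/h] = ℂ[h, h⁻¹][X₀]` (`isLocalization_L`) and hence the trivial line bundle over the punctured
line, the generic fiber and the integral fibers away from the origin.

Over `h = 0`, consider a node `e` at which the equations of its chain hold. There `R_e` is a nonzero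
constant because the labelling is fine, so `Q_e = 0` becomes `∏ (X_{Par(e)} - lb(c)) = 0` over the
children `c`, and the fiber splits into pairwise comaximal pieces, one for each child. Climbing to
the leaves gives `⋂ leafIdeal = I + (h)` (`iInf_leafIdeal`). On `C_e` the chain equations fix the
variables of the chain except `X_{Par(e)}`, and the simplified minors express the other variables by
it (`leafCoord_surjective`).

It remains to see that `C_e` is not smaller than a line and that `h` is not a zero divisor. Both
follow from an explicit family of points `ℂ[h][t]` through each leaf curve
(`exists_isSolution_leaf`): it satisfies all equations exactly, and modulo `h` it parametrizes `C_e`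
by an affine change of coordinate. Evaluation on it shows that `h`-power torsion vanishes modulo `h`
(`mem_of_pow_mul_mem`); a Fitting argument in the Noetherian ring `B` then removes the torsion.

Thus `B` embeds into `B[1/h]` and is a domain, flat over `ℂ[h]`. Since `(h)` is the intersection of
finitely many comaximal primes with quotients `ℂ[t]`, the ring `B` is normal, and a prime containing
`h` is locally generated by `h` and one further element, which gives regularity and dimension two.
-/

noncomputable section

namespace GDS

set_option linter.unusedSectionVars false

/-! ### Triangularity of the equations and factorizations along the tree -/

section Tree

variable {T : RootedTree.{0}} [Fintype T]

theorem xPar_of_covBy {e : T} {c : T} (h : e ⋖ c) :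
    (xPar c : Amb T) = MvPolynomial.X (some ⟨e, fun hm => hm.not_lt h.lt⟩) := by
  have hc : c ≠ ⊥ := fun hc => not_lt_bot (hc ▸ h.lt)
  simp only [xPar, dif_neg hc]
  congr 3
  exact pred_eq_of_covBy h

theorem xPar_bot : (xPar ⊥ : Amb T) = MvPolynomial.X none := by
  simp [xPar]

theorem pred_covBy {e : T} (h : e ≠ ⊥) : Order.pred e ⋖ e :=
  Order.pred_covBy_of_not_isMin fun hm => h hm.eq_bot

/-- The polynomials involving only `X₀` and the variables `X_d` with `d` an ancestor of `e`. -/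
def below (e : T) : Subalgebra ℂ[X] (Amb T) :=
  MvPolynomial.supported ℂ[X] {o | ∀ d ∈ o, d.1 < e}

theorem below_mono {e e' : T} (h : e ≤ e') : (below e : Subalgebra ℂ[X] (Amb T)) ≤ below e' :=
  MvPolynomial.supported_mono fun _ ho d hd => (ho d hd).trans_le h

theorem xPar_mem_below (e : T) : xPar e ∈ below e := by
  by_cases h : e = ⊥
  · rw [h, xPar_bot]
    exact MvPolynomial.X_mem_supported.2 (by simp)
  · rw [xPar_of_covBy (pred_covBy h)]
    refine MvPolynomial.X_mem_supported.2 fun d hd => ?_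
    cases hd
    exact (pred_covBy h).lt

theorem const_mem_below (e : T) (c : ℂ) : const c ∈ below e :=
  (below e).algebraMap_mem _

theorem aeval_congr_of_mem_below {R : Type*} [CommRing R] [Algebra ℂ[X] R] {e : T}
    {x y : Option (Parents T) → R} (h0 : x none = y none)
    (h : ∀ d : Parents T, d.1 < e → x (some d) = y (some d)) {p : Amb T} (hp : p ∈ below e) :
    MvPolynomial.aeval x p = MvPolynomial.aeval y p := by
  refine (AlgHom.eqOn_adjoin_iff (φ := MvPolynomial.aeval x) (ψ := MvPolynomial.aeval y)).2 ?_ hp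
  rintro _ ⟨o, ho, rfl⟩
  cases o with
  | none => simpa using h0
  | some d => simpa using h d (ho d rfl)

variable (lb : T → ℂ)

theorem sibPoly_mem_below (e : T) (J : Set T) : sibPoly lb e J ∈ below e :=
  Subalgebra.prod_mem _ fun _ _ => Subalgebra.sub_mem _ (xPar_mem_below e) (const_mem_below e _)

/-- The cofactor lies in `below e`, so dividing a minor by `R_c` does not spoil the triangular shape
of the equations. -/
theorem exists_rootPoly_eq_mul {c : T} (e : T) (hc : c ≤ e) :
    ∃ v ∈ below e, rootPoly lb e = rootPoly lb c * v := by
  induction e using WellFoundedLT.induction with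
  | ind e ih =>
    rcases hc.eq_or_lt with rfl | hlt
    · exact ⟨1, one_mem _, (mul_one _).symm⟩
    · have h : e ≠ ⊥ := fun h => not_lt_bot (h ▸ hlt)
      have hp := (pred_covBy h).lt
      obtain ⟨v, hv, hv'⟩ := ih _ hp (Order.le_pred_of_lt hlt)
      refine ⟨sibPoly lb (Order.pred e) {e} * v,
        mul_mem (below_mono hp.le (sibPoly_mem_below lb _ _)) (below_mono hp.le hv), ?_⟩
      rw [rootPoly_of_ne_bot lb h, hv']
      ring

theorem rootPoly_mem_below (e : T) : rootPoly lb e ∈ below e := by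
  obtain ⟨v, hv, h⟩ := exists_rootPoly_eq_mul lb e bot_le
  rw [h, rootPoly_bot, one_mul]
  exact hv

theorem qPoly_mem_below (e : T) : qPoly lb e ∈ below e :=
  mul_mem (sibPoly_mem_below lb _ _) (rootPoly_mem_below lb e)

theorem sibPoly_empty_eq {e c : T} (h : e ⋖ c) :
    sibPoly lb e ∅ = (xPar e - const (lb c)) * sibPoly lb e {c} := by
  classical
  rw [sibPoly, sibPoly, ← Finset.mul_prod_erase _ _ (a := c) (by simp [h])]
  congr 2
  ext f
  simp [and_comm]

theorem qPoly_eq {e c : T} (h : e ⋖ c) :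
    qPoly lb e = (xPar e - const (lb c)) * rootPoly lb c := by
  have hc : c ≠ ⊥ := fun hc => not_lt_bot (hc ▸ h.lt)
  rw [qPoly, sibPoly_empty_eq lb h, rootPoly_of_ne_bot lb hc, pred_eq_of_covBy h, mul_assoc]

/-- The explicit form of the simplified minor. -/
theorem exists_simplifiedMinor {d e : Parents T} {c : T} (hc : d.1 ⋖ c) (hce : c ≤ e.1) :
    ∃ w ∈ below e.1, (xPar d.1 - const (lb c)) * MvPolynomial.X (some e) -
      w * MvPolynomial.X (some d) ∈ idealI lb := by
  obtain ⟨v, hv, h⟩ := exists_rootPoly_eq_mul lb e.1 hce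
  refine ⟨sibPoly lb e.1 ∅ * v, mul_mem (sibPoly_mem_below lb _ _) hv, ?_⟩
  refine Ideal.subset_span (Or.inr ⟨d, e, hc.lt.trans_le hce, c, hc, hce, ?_⟩)
  rw [minor_some_some, qPoly_eq lb hc, qPoly, h]
  ring

theorem minor_none_some (e : Parents T) : minor lb none (some e) =
    hVar * MvPolynomial.X (some e) - qPoly lb e.1 := by
  simp [minor, matM, Matrix.det_fin_two]

theorem hVar_mul_sub_qPoly_mem (e : Parents T) :
    hVar * MvPolynomial.X (some e) - qPoly lb e.1 ∈ idealI lb :=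
  Ideal.subset_span (Or.inl ⟨e, (minor_none_some lb e).symm⟩)

/-- Every `Q_d` has a factor vanishing on the curve of a given leaf. -/
theorem exists_factor_dvd_qPoly (e : Leaves T) (d : Parents T) :
    ∃ f : T, f ≠ ⊥ ∧ f ≤ e.1 ∧ (xPar (Order.pred f) - const (lb f)) ∣ qPoly lb d.1 := by
  -- The factor comes from the step `f` that leaves the meet of `d` and `e` towards `e`. If the meet
  -- is `d`, it is a factor of `S_d`; otherwise `f` is a sibling of the step `g` towards `d`, and
  -- the factor occurs in `R_g`.
  have hm : d.1 ⊓ e.1 < e.1 := by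
    refine lt_of_le_of_ne inf_le_right fun h => ?_
    have hed : e.1 ≤ d.1 := inf_eq_right.1 h
    exact d.2 (e.2.eq_of_le hed ▸ e.2)
  obtain ⟨f, hf, hfe⟩ := exists_covBy_le_of_lt hm
  refine ⟨f, fun h => not_lt_bot (h ▸ hf.lt), hfe, ?_⟩
  rw [pred_eq_of_covBy hf]
  rcases (inf_le_left : d.1 ⊓ e.1 ≤ d.1).eq_or_lt with h | h
  · rw [h] at hf ⊢
    exact ⟨_, qPoly_eq lb hf⟩
  · obtain ⟨g, hg, hgd⟩ := exists_covBy_le_of_lt h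
    refine Dvd.dvd.trans ?_ ((rootPoly_dvd lb _ hgd).mul_left _)
    rw [rootPoly_of_ne_bot lb (fun h => not_lt_bot (h ▸ hg.lt)), pred_eq_of_covBy hg]
    refine Dvd.dvd.mul_right (Finset.dvd_prod_of_mem (fun f => xPar _ - const (lb f)) ?_) _
    simp only [Finset.mem_filter, Finset.mem_univ, true_and, Set.mem_singleton_iff]
    refine ⟨hf, ?_⟩
    rintro rfl
    exact hf.lt.not_ge (le_inf hgd hfe)

@[simp] theorem const_sub (a b : ℂ) : (const (a - b) : Amb T) = const a - const b := by
  simp [const]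

variable {lb}

/-- Modulo the equations of the chain below `c`, the polynomial `R_c` is a nonzero constant. -/
theorem exists_rootPoly_sub_const_mem (hlb : IsFine lb) (N : Ideal (Amb T)) (c : T)
    (hN : ∀ f ≤ c, f ≠ ⊥ → xPar (Order.pred f) - const (lb f) ∈ N) :
    ∃ u : ℂ, u ≠ 0 ∧ rootPoly lb c - const u ∈ N := by
  classical
  induction c using WellFoundedLT.induction with
  | ind c ih =>
    by_cases h : c = ⊥
    · exact ⟨1, one_ne_zero, by simp [h, rootPoly_bot, const]⟩
    obtain ⟨u, hu, hu'⟩ := ih _ (pred_covBy h).lt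
      fun f hf hf0 => hN f (hf.trans (pred_covBy h).le) hf0
    -- Modulo `N` the variable in the sibling product takes the value `lb c`, so each factor becomes
    -- `lb c - lb f`, nonzero by fineness.
    refine ⟨(∏ f ∈ Finset.univ.filter (fun f : T => Order.pred c ⋖ f ∧ f ∉ ({c} : Set T)),
      (lb c - lb f)) * u, mul_ne_zero (Finset.prod_ne_zero_iff.2 fun f hf => ?_) hu, ?_⟩
    · simp only [Finset.mem_filter, Finset.mem_univ, true_and, Set.mem_singleton_iff] at hf
      exact sub_ne_zero.2 (hlb _ _ _ (pred_covBy h) hf.1 (Ne.symm hf.2))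
    · rw [← Ideal.Quotient.eq] at hu' ⊢
      have key := Ideal.Quotient.eq.2 (hN c le_rfl h)
      rw [rootPoly_of_ne_bot lb h, map_mul, hu']
      have hmul (a b : ℂ) : (const (a * b) : Amb T) = const a * const b := by simp [const]
      have hprod (s : Finset T) : (const (∏ f ∈ s, (lb c - lb f)) : Amb T) =
          ∏ f ∈ s, (const (lb c) - const (lb f)) := by
        simp [const]
      rw [hmul, map_mul, hprod, sibPoly, map_prod, map_prod]
      simp only [map_sub, key]
      congr! 2

/-! ### Splitting of the fiber over the origin -/

variable (lb)

/-- The analogue of the ideal of a leaf for an arbitrary node. -/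
def nodeIdeal (e : T) : Ideal (Amb T) :=
  idealI lb ⊔ Ideal.span
    ({hVar} ∪ {d | ∃ f : T, f ≠ ⊥ ∧ f ≤ e ∧ d = xPar (Order.pred f) - const (lb f)})

theorem idealI_le_nodeIdeal (e : T) : idealI lb ≤ nodeIdeal lb e := le_sup_left

theorem hVar_mem_nodeIdeal (e : T) : hVar ∈ nodeIdeal lb e :=
  Ideal.mem_sup_right (Ideal.subset_span (Or.inl rfl))

theorem xPar_pred_sub_const_mem {e f : T} (hf : f ≠ ⊥) (hfe : f ≤ e) :
    xPar (Order.pred f) - const (lb f) ∈ nodeIdeal lb e :=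
  Ideal.mem_sup_right (Ideal.subset_span (Or.inr ⟨f, hf, hfe, rfl⟩))

theorem xPar_sub_const_mem {e c f : T} (hf : e ⋖ c) (hce : c ≤ f) :
    xPar e - const (lb c) ∈ nodeIdeal lb f := by
  have := xPar_pred_sub_const_mem lb (fun h => not_lt_bot (h ▸ hf.lt)) hce
  rwa [pred_eq_of_covBy hf] at this

theorem nodeIdeal_bot : nodeIdeal lb ⊥ = idealI lb ⊔ Ideal.span {hVar} := by
  rw [nodeIdeal]
  congr 2
  simp only [le_bot_iff, Set.union_eq_left]
  rintro _ ⟨f, hf, hf', -⟩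
  exact absurd hf' hf

theorem nodeIdeal_le_sup {e c : T} (h : e ⋖ c) :
    nodeIdeal lb c ≤ nodeIdeal lb e ⊔ Ideal.span {xPar e - const (lb c)} := by
  refine sup_le ((idealI_le_nodeIdeal lb e).trans le_sup_left) (Ideal.span_le.2 ?_)
  rintro _ (rfl | ⟨f, hf, hfc, rfl⟩)
  · exact Ideal.mem_sup_left (hVar_mem_nodeIdeal lb e)
  · rcases hfc.eq_or_lt with rfl | hlt
    · rw [pred_eq_of_covBy h]
      exact Ideal.mem_sup_right (Ideal.subset_span rfl)
    · exact Ideal.mem_sup_left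
        (xPar_pred_sub_const_mem lb hf (pred_eq_of_covBy h ▸ Order.le_pred_of_lt hlt))

theorem isUnit_const {a : ℂ} (ha : a ≠ 0) : IsUnit (const a : Amb T) :=
  (((isUnit_iff_ne_zero.2 ha).map Polynomial.C).map MvPolynomial.C)

variable {lb}

/-- On the two branches the same variable `X_{Par(e)}` takes the distinct values `lb c` and `lb c'`.
-/
theorem isCoprime_nodeIdeal (hlb : IsFine lb) {e c c' f f' : T} (hc : e ⋖ c) (hc' : e ⋖ c')
    (hne : c ≠ c') (hf : c ≤ f) (hf' : c' ≤ f') :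
    IsCoprime (nodeIdeal lb f) (nodeIdeal lb f') := by
  rw [Ideal.isCoprime_iff_sup_eq]
  refine Ideal.eq_top_of_isUnit_mem _ ?_
    (isUnit_const (sub_ne_zero.2 (hlb e c c' hc hc' hne)))
  have := Ideal.sub_mem (nodeIdeal lb f ⊔ nodeIdeal lb f')
    (Ideal.mem_sup_right (xPar_sub_const_mem lb hc' hf'))
    (Ideal.mem_sup_left (xPar_sub_const_mem lb hc hf))
  simpa using this

theorem exists_covBy_ne {e e' : T} (h : ¬ e ≤ e') (h' : ¬ e' ≤ e) :
    ∃ d c c', d ⋖ c ∧ d ⋖ c' ∧ c ≠ c' ∧ c ≤ e ∧ c' ≤ e' := by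
  have h1 : e ⊓ e' < e := lt_of_le_of_ne inf_le_left fun h0 => h (inf_eq_left.1 h0)
  have h2 : e ⊓ e' < e' := lt_of_le_of_ne inf_le_right fun h0 => h' (inf_eq_right.1 h0)
  obtain ⟨c, hc, hce⟩ := exists_covBy_le_of_lt h1
  obtain ⟨c', hc', hce'⟩ := exists_covBy_le_of_lt h2
  refine ⟨_, c, c', hc, hc', ?_, hce, hce'⟩
  rintro rfl
  exact hc.lt.not_ge (le_inf hce hce')

theorem isCoprime_leafIdeal (hlb : IsFine lb) {e e' : Leaves T} (h : e ≠ e') :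
    IsCoprime (leafIdeal lb e) (leafIdeal lb e') := by
  obtain ⟨d, c, c', hc, hc', hne, hce, hce'⟩ := exists_covBy_ne
    (fun h0 => h (Subtype.ext (e.2.eq_of_le h0))) fun h0 => h (Subtype.ext (e'.2.eq_of_le h0).symm)
  exact isCoprime_nodeIdeal hlb hc hc' hne hce hce'

theorem prod_sup_span_le {R ι : Type*} [CommRing R] (s : Finset ι) (J : Ideal R) (a : ι → R) :
    ∏ i ∈ s, (J ⊔ Ideal.span {a i}) ≤ J ⊔ Ideal.span {∏ i ∈ s, a i} := by
  classical
  induction s using Finset.induction_on with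
  | empty => simp
  | insert i s hi ih =>
    rw [Finset.prod_insert hi, Finset.prod_insert hi]
    refine (Ideal.mul_mono le_rfl ih).trans ?_
    rw [← Ideal.span_singleton_mul_span_singleton, Ideal.sup_mul, Ideal.mul_sup, Ideal.mul_sup]
    exact sup_le (sup_le (Ideal.mul_le_left.trans le_sup_left) (Ideal.mul_le_left.trans le_sup_left))
      (sup_le (Ideal.mul_le_right.trans le_sup_left) le_sup_right)

/-- From `h X_e = S_e R_e` with `h = 0` and `R_e` a unit constant one gets `S_e = 0` modulo
`nodeIdeal lb e`. The ideals of the children are comaximal, so their intersection is their product,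
which is contained in `nodeIdeal lb e + (S_e)`. -/
theorem iInf_children_le (hlb : IsFine lb) (e : Parents T) :
    ⨅ c : {c : T // e.1 ⋖ c}, nodeIdeal lb c.1 ≤ nodeIdeal lb e.1 := by
  classical
  have hS : sibPoly lb e.1 ∅ ∈ nodeIdeal lb e.1 := by
    obtain ⟨u, hu, hu'⟩ := exists_rootPoly_sub_const_mem hlb (nodeIdeal lb e.1) e.1
      fun f hf hf0 => xPar_pred_sub_const_mem lb hf0 hf
    have h1 := idealI_le_nodeIdeal lb e.1 (hVar_mul_sub_qPoly_mem lb e)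
    have h2 := (nodeIdeal lb e.1).mul_mem_right (MvPolynomial.X (some e))
      (hVar_mem_nodeIdeal lb e.1)
    have h3 := Ideal.sub_mem _ h2 h1
    rw [sub_sub_cancel, qPoly] at h3
    have h4 := Ideal.sub_mem _ h3 ((nodeIdeal lb e.1).mul_mem_left (sibPoly lb e.1 ∅) hu')
    rw [← mul_sub, sub_sub_cancel] at h4
    exact (Ideal.mul_unit_mem_iff_mem _ (isUnit_const hu)).1 h4
  have hprod := Ideal.prod_eq_iInf_of_pairwise_isCoprime (s := Finset.univ)
    (J := fun c : {c : T // e.1 ⋖ c} => nodeIdeal lb c.1)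
    fun c _ c' _ hne => isCoprime_nodeIdeal hlb c.2 c'.2 (fun h => hne (Subtype.ext h)) le_rfl le_rfl
  simp only [Finset.mem_univ, iInf_pos] at hprod
  rw [← hprod]
  refine (Finset.prod_le_prod' fun c _ => nodeIdeal_le_sup lb c.2).trans
    ((prod_sup_span_le _ _ _).trans (sup_le le_rfl ?_))
  rw [Ideal.span_singleton_le_iff_mem]
  convert hS
  rw [sibPoly]
  refine (Finset.prod_subtype (F := inferInstance) _ (fun f => ?_)
    (fun f => (xPar e.1 - const (lb f) : Amb T))).symm
  simp

theorem iInf_leafIdeal_le_nodeIdeal (hlb : IsFine lb) (e : T) :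
    ⨅ l : {l : Leaves T // e ≤ l.1}, leafIdeal lb l.1 ≤ nodeIdeal lb e := by
  induction e using WellFoundedGT.induction with
  | ind e ih =>
    by_cases he : IsMax e
    -- At a leaf, `nodeIdeal` and `leafIdeal` agree by definition.
    · exact iInf_le (fun l : {l : Leaves T // e ≤ l.1} => leafIdeal lb l.1) ⟨⟨e, he⟩, le_rfl⟩
    · refine le_trans (le_iInf fun c => ?_) (iInf_children_le hlb ⟨e, he⟩)
      refine le_trans (le_iInf fun l => ?_) (ih c.1 c.2.lt)
      exact iInf_le (fun l : {l : Leaves T // e ≤ l.1} => leafIdeal lb l.1)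
        ⟨l.1, c.2.le.trans l.2⟩

theorem iInf_leafIdeal (hlb : IsFine lb) :
    ⨅ l : Leaves T, leafIdeal lb l = idealI lb ⊔ Ideal.span {hVar} := by
  refine le_antisymm ?_ (le_iInf fun l => sup_le (idealI_le_nodeIdeal lb l.1) ?_)
  · rw [← nodeIdeal_bot]
    refine le_trans ?_ (iInf_leafIdeal_le_nodeIdeal hlb ⊥)
    exact le_iInf fun l => iInf_le (fun l : Leaves T => leafIdeal lb l) l.1
  · exact (Ideal.span_singleton_le_iff_mem _).2 (hVar_mem_nodeIdeal lb l.1)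

end Tree

/-! ### Solutions of the equations and the curves of the fiber -/

section Curves

variable {T : RootedTree.{0}} [Fintype T] (lb : T → ℂ)

/-- An assignment of values to the variables of `A[Γ]` satisfying `h X_e = Q_e` for all `e`. -/
def IsSolution {R : Type*} [CommRing R] [Algebra ℂ[X] R] (x : Option (Parents T) → R) : Prop :=
  ∀ e : Parents T, algebraMap ℂ[X] R Polynomial.X * x (some e) =
    MvPolynomial.aeval x (qPoly lb e.1)

section Solutions

variable {R : Type*} [CommRing R] [Algebra ℂ[X] R]

/-- Here `D` stands for division by `h`: multiplication by `h⁻¹` over `ℂ[h, h⁻¹]`, and exact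
division of multiples of `h` over `ℂ[h]`. -/
theorem exists_assignment (D : R → R) (s : R) :
    ∃ x : Option (Parents T) → R, x none = s ∧
      ∀ e : Parents T, x (some e) = D (MvPolynomial.aeval x (qPoly lb e.1)) := by
  classical
  let F (e : Parents T) (ih : ∀ d : Parents T, d < e → R) : R :=
    -- The default value `0` is immaterial, since `Q_e` involves only the variables of ancestors of
    -- `e`.
    D (MvPolynomial.aeval (fun o => o.elim s fun d => if h : d < e then ih d h else 0)
      (qPoly lb e.1))
  let g : Parents T → R := (wellFounded_lt (α := Parents T)).fix F
  refine ⟨fun o => o.elim s g, rfl, fun e => ?_⟩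
  refine ((wellFounded_lt (α := Parents T)).fix_eq F e).trans (congrArg D ?_)
  refine aeval_congr_of_mem_below (R := R)
    (x := fun o => o.elim s fun d => if d < e then g d else 0) (y := fun o => o.elim s g) rfl (fun d hd => ?_) (qPoly_mem_below lb e.1)
  exact dif_pos (show d < e from hd)

theorem aeval_hVar (x : Option (Parents T) → R) :
    MvPolynomial.aeval x (hVar : Amb T) = algebraMap ℂ[X] R Polynomial.X := by
  simp [hVar]

theorem aeval_const (x : Option (Parents T) → R) (c : ℂ) :
    MvPolynomial.aeval x (const c : Amb T) = algebraMap ℂ[X] R (Polynomial.C c) := by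
  simp [const]

variable {lb}

/-- Multiplied by `h`, the minor becomes `Q_{e'} Q_e - Q_e Q_{e'}`. -/
theorem IsSolution.aeval_minor_some_some [IsDomain R] {x : Option (Parents T) → R}
    (hx : IsSolution lb x) (h0 : algebraMap ℂ[X] R Polynomial.X ≠ 0) (e' e : Parents T) :
    MvPolynomial.aeval x (minor lb (some e') (some e)) = 0 := by
  refine mul_left_cancel₀ h0 ?_
  rw [minor_some_some, map_sub, map_mul, map_mul, ← hx, ← hx, MvPolynomial.aeval_X,
    MvPolynomial.aeval_X]
  ring

/-- The nonvanishing of the `R_e` allows passing from the minors to the simplified minors. -/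
theorem IsSolution.idealI_le_ker [IsDomain R] {x : Option (Parents T) → R}
    (hx : IsSolution lb x) (h0 : algebraMap ℂ[X] R Polynomial.X ≠ 0)
    (hr : ∀ e, MvPolynomial.aeval x (rootPoly lb e) ≠ 0) :
    idealI lb ≤ RingHom.ker (MvPolynomial.aeval x : Amb T →ₐ[ℂ[X]] R) := by
  refine Ideal.span_le.2 ?_
  rintro _ (⟨e, rfl⟩ | ⟨e', e, -, c, -, -, h⟩)
  · simp [minor_none_some, aeval_hVar, hx e]
  · have := hx.aeval_minor_some_some h0 e' e
    rw [← h, map_mul] at this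
    exact (mul_eq_zero.1 this).resolve_left (hr c)

end Solutions

section Degree

variable {K : Type*} [CommRing K] [IsDomain K] [Algebra ℂ[X] K]
variable {x : Option (Parents T) → K[X]}

theorem algebraMap_polynomial_X : algebraMap ℂ[X] K[X] Polynomial.X =
    Polynomial.C (algebraMap ℂ[X] K Polynomial.X) := rfl

theorem natDegree_aeval_sub_const (p : Amb T) (c : ℂ) :
    (MvPolynomial.aeval x (p - const c)).natDegree = (MvPolynomial.aeval x p).natDegree := by
  rw [map_sub, aeval_const]
  exact Polynomial.natDegree_sub_C

variable {lb}

theorem aeval_sub_const_ne_zero {p : Amb T} (h : 0 < (MvPolynomial.aeval x p).natDegree) (c : ℂ) :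
    MvPolynomial.aeval x (p - const c) ≠ 0 := by
  intro h0
  rw [← natDegree_aeval_sub_const p c, h0] at h
  simp at h

/-- A nonconstant polynomial minus a constant is nonzero, so the sibling factors do not vanish.
Comparing degrees in `h X_d = (X_{Par(d)} - lb(e)) R_e`, for `e` a child of `d`, shows that the
value of `X_d` is again nonconstant. -/
theorem IsSolution.natDegree_aeval_xPar_pos (hx : IsSolution lb x)
    (h0 : algebraMap ℂ[X] K Polynomial.X ≠ 0) (hdeg : 0 < (x none).natDegree) (e : T) :
    0 < (MvPolynomial.aeval x (xPar e)).natDegree ∧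
      MvPolynomial.aeval x (rootPoly lb e) ≠ 0 := by
  induction e using WellFoundedLT.induction with
  | ind e ih =>
    by_cases h : e = ⊥
    · subst h
      simpa [xPar_bot, rootPoly_bot] using hdeg
    have hp := pred_covBy h
    obtain ⟨ih1, ih2⟩ := ih _ hp.lt
    have hr : MvPolynomial.aeval x (rootPoly lb e) ≠ 0 := by
      rw [rootPoly_of_ne_bot lb h, map_mul]
      refine mul_ne_zero ?_ ih2
      rw [sibPoly, map_prod]
      exact Finset.prod_ne_zero_iff.2 fun f _ => aeval_sub_const_ne_zero ih1 _
    refine ⟨?_, hr⟩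
    have key := congrArg Polynomial.natDegree (hx ⟨Order.pred e, pred_not_isMax h⟩)
    rw [algebraMap_polynomial_X, Polynomial.natDegree_C_mul h0, qPoly_eq lb hp, map_mul,
      Polynomial.natDegree_mul (aeval_sub_const_ne_zero ih1 _) hr, natDegree_aeval_sub_const] at key
    rw [xPar_of_covBy hp, MvPolynomial.aeval_X, key]
    exact Nat.lt_add_right _ ih1

theorem IsSolution.idealI_le_ker_of_natDegree_pos (hx : IsSolution lb x)
    (h0 : algebraMap ℂ[X] K Polynomial.X ≠ 0) (hdeg : 0 < (x none).natDegree) :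
    idealI lb ≤ RingHom.ker (MvPolynomial.aeval x : Amb T →ₐ[ℂ[X]] K[X]) :=
  hx.idealI_le_ker (by rwa [algebraMap_polynomial_X, Ne, Polynomial.C_eq_zero])
    fun e => (hx.natDegree_aeval_xPar_pos h0 hdeg e).2

end Degree

/-! ### Power series type solutions along a chain -/

/-- Reduction modulo `h` of polynomials over `ℂ[h]`. -/
def redH : ℂ[X][X] →+* ℂ[X] := Polynomial.mapRingHom (Polynomial.evalRingHom 0)

@[simp] theorem redH_C (p : ℂ[X]) : redH (Polynomial.C p) = Polynomial.C (p.eval 0) := by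
  simp [redH]

@[simp] theorem redH_X : redH Polynomial.X = Polynomial.X := by
  simp [redH]

@[simp] theorem redH_algebraMap (p : ℂ[X]) :
    redH (algebraMap ℂ[X] ℂ[X][X] p) = Polynomial.C (p.eval 0) := redH_C p

theorem exists_eq_mul_of_redH_eq_zero {p : ℂ[X][X]} (h : redH p = 0) :
    ∃ r, p = algebraMap ℂ[X] ℂ[X][X] Polynomial.X * r := by
  refine (Polynomial.C_dvd_iff_dvd_coeff _ _).2 fun i => ?_
  have := congrArg (fun q => Polynomial.coeff q i) h
  simp only [redH, Polynomial.coe_mapRingHom, Polynomial.coeff_map, Polynomial.coe_evalRingHom,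
    Polynomial.coeff_zero] at this
  rwa [Polynomial.X_dvd_iff, Polynomial.coeff_zero_eq_eval_zero]

/-- The substitution `t ↦ τ + h t`. -/
def shift (τ : ℂ) : ℂ[X][X] →ₐ[ℂ[X]] ℂ[X][X] :=
  Polynomial.aeval (Polynomial.C (Polynomial.C τ) + Polynomial.C Polynomial.X * Polynomial.X)

theorem redH_shift (τ : ℂ) (p : ℂ[X][X]) :
    redH (shift τ p) = Polynomial.C ((redH p).eval τ) := by
  induction p using Polynomial.induction_on' with
  | add p q hp hq => simp [hp, hq]
  | monomial n a => simp [shift, ← Polynomial.C_mul_X_pow_eq_monomial]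

theorem natDegree_shift (τ : ℂ) (p : ℂ[X][X]) : (shift τ p).natDegree = p.natDegree := by
  rw [shift, ← Polynomial.comp_eq_aeval, Polynomial.natDegree_comp]
  have : (Polynomial.C (Polynomial.C τ) + Polynomial.C Polynomial.X * Polynomial.X :
      ℂ[X][X]).natDegree = 1 := by
    rw [add_comm]
    exact Polynomial.natDegree_linear Polynomial.X_ne_zero
  rw [this, mul_one]

/-- A solution of the equations of the ancestors of `e`, adapted to the chain below `e`. -/
structure IsChainSolution (e : T) (x : Option (Parents T) → ℂ[X][X]) : Prop where
  eq : ∀ d : Parents T, d.1 < e → algebraMap ℂ[X] ℂ[X][X] Polynomial.X * x (some d) =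
    MvPolynomial.aeval x (qPoly lb d.1)
  red : ∀ f ≤ e, f ≠ ⊥ → redH (MvPolynomial.aeval x (xPar (Order.pred f))) = Polynomial.C (lb f)
  linear : ∃ a b : ℂ, b ≠ 0 ∧ redH (MvPolynomial.aeval x (xPar e)) =
    Polynomial.C a + Polynomial.C b * Polynomial.X
  deg : 0 < (x none).natDegree

variable {lb}

theorem aeval_comp_shift (τ : ℂ) (x : Option (Parents T) → ℂ[X][X]) (p : Amb T) :
    MvPolynomial.aeval (fun o => shift τ (x o)) p = shift τ (MvPolynomial.aeval x p) := by
  refine DFunLike.congr_fun (MvPolynomial.algHom_ext (f := MvPolynomial.aeval _)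
    (g := (shift τ).comp (MvPolynomial.aeval x)) fun o => ?_) p
  simp

theorem IsChainSolution.aeval_congr {e : T} {x y : Option (Parents T) → ℂ[X][X]}
    (hx : IsChainSolution lb e x) (h0 : x none = y none)
    (h : ∀ d : Parents T, d.1 < e → x (some d) = y (some d)) : IsChainSolution lb e y where
  eq d hd := by
    rw [← h d hd, hx.eq d hd]
    exact aeval_congr_of_mem_below h0 (fun d' hd' => h d' (hd'.trans hd)) (qPoly_mem_below lb _)
  red f hf hf0 := by
    rw [← hx.red f hf hf0]
    refine congrArg _ (aeval_congr_of_mem_below h0 h ?_).symm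
    exact below_mono ((Order.pred_le f).trans hf) (xPar_mem_below _)
  linear := by
    rw [← aeval_congr_of_mem_below h0 h (xPar_mem_below e)]
    exact hx.linear
  deg := h0 ▸ hx.deg

/-- The ideal of the polynomials vanishing modulo `h` under an assignment. -/
def redKer (x : Option (Parents T) → ℂ[X][X]) : Ideal (Amb T) :=
  RingHom.ker (redH.comp (MvPolynomial.aeval x : Amb T →ₐ[ℂ[X]] ℂ[X][X]).toRingHom)

theorem mem_redKer {x : Option (Parents T) → ℂ[X][X]} {p : Amb T} :
    p ∈ redKer x ↔ redH (MvPolynomial.aeval x p) = 0 := Iff.rfl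

theorem sub_const_mem_redKer {x : Option (Parents T) → ℂ[X][X]} {p : Amb T} {c : ℂ} :
    p - const c ∈ redKer x ↔ redH (MvPolynomial.aeval x p) = Polynomial.C c := by
  rw [mem_redKer, map_sub, map_sub, aeval_const, redH_algebraMap, Polynomial.eval_C, sub_eq_zero]

/-- The substitution `t ↦ τ + h t` zooms in on the point of the line where `X_{Par(e)} = lb c`, as
an affine modification does. It makes `X_{Par(e)} - lb c` divisible by `h`, so that `X_e` can be
solved for, and the quotient is again linear in `t` modulo `h`. -/
theorem IsChainSolution.exists_child (hlb : IsFine lb) {e c : T} (hec : e ⋖ c)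
    {x : Option (Parents T) → ℂ[X][X]} (hx : IsChainSolution lb e x) :
    ∃ y, IsChainSolution lb c y := by
  classical
  obtain ⟨a, b, hb, hab⟩ := hx.linear
  obtain ⟨g, hg⟩ := exists_eq_mul_of_redH_eq_zero (p := MvPolynomial.aeval x (xPar e) -
    (Polynomial.C (Polynomial.C a) + Polynomial.C (Polynomial.C b) * Polynomial.X))
    (by simp [hab])
  rw [sub_eq_iff_eq_add] at hg
  -- The root of `a + b τ = lb c`.
  let τ : ℂ := (lb c - a) / b
  let z : Option (Parents T) → ℂ[X][X] := fun o => shift τ (x o)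
  -- The quotient of `X_{Par(e)} - lb c` by `h` after the substitution.
  let U : ℂ[X][X] := Polynomial.C (Polynomial.C b) * Polynomial.X + shift τ g
  have hU : MvPolynomial.aeval z (xPar e - const (lb c)) =
      algebraMap ℂ[X] ℂ[X][X] Polynomial.X * U := by
    have hτ : lb c = a + b * τ := by
      simp only [τ]
      field_simp
      ring
    rw [map_sub, aeval_const, aeval_comp_shift, hg, hτ]
    simp only [shift, map_add, map_mul, Polynomial.aeval_C, Polynomial.aeval_X, U,
      Polynomial.algebraMap_eq]
    ring
  let pe : Parents T := ⟨e, fun hm => hm.not_lt hec.lt⟩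
  -- The value of `X_e` is forced by `h X_e = (X_{Par(e)} - lb c) R_c = h U R_c`.
  let y := Function.update z (some pe) (U * MvPolynomial.aeval z (rootPoly lb c))
  have hyz (d : Parents T) (hd : d.1 < e) : y (some d) = z (some d) :=
    Function.update_of_ne (fun h => hd.ne (congrArg Subtype.val (Option.some_injective _ h))) _ _
  have hyz0 : y none = z none := Function.update_of_ne (by simp) _ _
  have hsub {p : Amb T} (hp : p ∈ below e) :
      MvPolynomial.aeval y p = MvPolynomial.aeval z p := aeval_congr_of_mem_below hyz0 hyz hp
  have hz : ∀ f ≤ e, f ≠ ⊥ →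
      redH (MvPolynomial.aeval z (xPar (Order.pred f))) = Polynomial.C (lb f) := fun f hf hf0 => by
    rw [aeval_comp_shift, redH_shift, hx.red f hf hf0, Polynomial.eval_C]
  have hzc : redH (MvPolynomial.aeval z (xPar e)) = Polynomial.C (lb c) := by
    rw [← sub_const_mem_redKer, mem_redKer, hU]
    simp
  have hle : ∀ f ≤ c, f ≠ ⊥ →
      redH (MvPolynomial.aeval z (xPar (Order.pred f))) = Polynomial.C (lb f) := fun f hf hf0 => by
    rcases hf.eq_or_lt with rfl | hlt
    · rw [pred_eq_of_covBy hec, hzc]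
    · exact hz f (pred_eq_of_covBy hec ▸ Order.le_pred_of_lt hlt) hf0
  have hRc : rootPoly lb c ∈ below e := by
    have hc : c ≠ ⊥ := fun hc => not_lt_bot (hc ▸ hec.lt)
    rw [rootPoly_of_ne_bot lb hc, pred_eq_of_covBy hec]
    exact mul_mem (sibPoly_mem_below lb _ _) (rootPoly_mem_below lb e)
  refine ⟨y, ⟨fun d hd => ?_, fun f hf hf0 => ?_, ?_, ?_⟩⟩
  · have hde : d.1 ≤ e := pred_eq_of_covBy hec ▸ Order.le_pred_of_lt hd
    rw [hsub (below_mono hde (qPoly_mem_below lb _))]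
    rcases hde.eq_or_lt with h | h
    · obtain rfl : d = pe := Subtype.ext h
      rw [qPoly_eq lb hec, map_mul, hU, mul_assoc]
      exact congrArg _ (Function.update_self _ _ _)
    · rw [hyz d h, aeval_comp_shift, ← hx.eq d h, map_mul, AlgHom.commutes]
  · rw [hsub, hle f hf hf0]
    have : Order.pred f ≤ e := pred_eq_of_covBy hec ▸ Order.pred_mono hf
    exact below_mono this (xPar_mem_below _)
  · obtain ⟨u, hu, hu'⟩ := exists_rootPoly_sub_const_mem hlb (redKer z) c
      fun f hf hf0 => sub_const_mem_redKer.2 (hle f hf hf0)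
    rw [sub_const_mem_redKer] at hu'
    -- Modulo `h` one has `U = b t + g(τ)` and `R_c = u`, and `X_e` is their product.
    refine ⟨u * (redH g).eval τ, u * b, mul_ne_zero hu hb, ?_⟩
    rw [xPar_of_covBy hec, MvPolynomial.aeval_X]
    have : y (some pe) = U * MvPolynomial.aeval z (rootPoly lb c) := Function.update_self _ _ _
    rw [this, map_mul, hu']
    simp only [U, map_add, map_mul, redH_C, redH_X, redH_shift, Polynomial.eval_C]
    ring
  · rw [hyz0]
    simpa only [z, natDegree_shift] using hx.deg

theorem exists_isChainSolution (hlb : IsFine lb) (e : T) : ∃ x, IsChainSolution lb e x := by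
  induction e using WellFoundedLT.induction with
  | ind e ih =>
    by_cases h : e = ⊥
    · subst h
      refine ⟨fun _ => Polynomial.X, ⟨fun d hd => absurd hd not_lt_bot,
        fun f hf hf0 => absurd (le_bot_iff.1 hf) hf0, ⟨0, 1, one_ne_zero, ?_⟩, by simp⟩⟩
      simp [xPar_bot]
    · obtain ⟨x, hx⟩ := ih _ (pred_covBy h).lt
      exact hx.exists_child hlb (pred_covBy h)

/-- A chain solution extends to all variables because every `Q_d` has a factor vanishing modulo `h`
on the chain of `e`, hence can be divided by `h`. -/
theorem exists_isSolution_leaf (hlb : IsFine lb) (e : Leaves T) :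
    ∃ x, IsChainSolution lb e.1 x ∧ IsSolution lb x := by
  classical
  obtain ⟨z, hz⟩ := exists_isChainSolution hlb e.1
  -- The value `0` on polynomials not divisible by `h` is never reached by the assignment built
  -- below.
  let D : ℂ[X][X] → ℂ[X][X] := fun p =>
    if h : redH p = 0 then (exists_eq_mul_of_redH_eq_zero h).choose else 0
  have hD {p} (h : redH p = 0) : algebraMap ℂ[X] ℂ[X][X] Polynomial.X * D p = p := by
    simp only [D, dif_pos h]
    exact (exists_eq_mul_of_redH_eq_zero h).choose_spec.symm
  have hX : algebraMap ℂ[X] ℂ[X][X] Polynomial.X ≠ 0 := by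
    simp [Polynomial.algebraMap_eq]
  obtain ⟨x, hx0, hx⟩ := exists_assignment lb D (z none)
  -- Division by `h` is unique, so the new assignment agrees with the chain solution on the
  -- ancestors of `e`.
  have hzx (d : Parents T) (hd : d.1 < e.1) : z (some d) = x (some d) := by
    induction d using WellFoundedLT.induction with
    | ind d ih =>
      have h1 := hz.eq d hd
      rw [aeval_congr_of_mem_below hx0.symm (fun d' hd' => ih d' hd' (hd'.trans hd))
        (qPoly_mem_below lb _)] at h1
      have h2 : redH (MvPolynomial.aeval x (qPoly lb d.1)) = 0 := by
        rw [← h1]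
        simp
      rw [hx d]
      exact mul_left_cancel₀ hX (h1.trans (hD h2).symm)
  have hxe := hz.aeval_congr hx0.symm hzx
  refine ⟨x, hxe, fun d => ?_⟩
  rw [hx d]
  refine hD ?_
  obtain ⟨f, hf0, hf, r, hr⟩ := exists_factor_dvd_qPoly lb e d
  rw [← mem_redKer, hr]
  exact Ideal.mul_mem_right _ _ (sub_const_mem_redKer.2 (hxe.red f hf hf0))

theorem leafIdeal_le_redKer (e : Leaves T) {x : Option (Parents T) → ℂ[X][X]}
    (hx : IsChainSolution lb e.1 x) (hx' : IsSolution lb x) : leafIdeal lb e ≤ redKer x := by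
  refine sup_le (fun p hp => ?_) (Ideal.span_le.2 ?_)
  · have := hx'.idealI_le_ker_of_natDegree_pos (by simp) hx.deg hp
    rw [mem_redKer, RingHom.mem_ker.1 this, map_zero]
  · rintro _ (rfl | ⟨f, hf0, hf, rfl⟩)
    · simp [mem_redKer, aeval_hVar]
    · exact sub_const_mem_redKer.2 (hx.red f hf hf0)

/-- The homomorphism from the coordinate ring of `C_e` induced by an assignment. -/
def leafEval {e : Leaves T} {x : Option (Parents T) → ℂ[X][X]} (hx : leafIdeal lb e ≤ redKer x) :
    (Amb T ⧸ leafIdeal lb e) →+* ℂ[X] :=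
  Ideal.Quotient.lift (leafIdeal lb e)
    (redH.comp (MvPolynomial.aeval x : Amb T →ₐ[ℂ[X]] ℂ[X][X]).toRingHom) fun _ h => hx h

theorem leafEval_mk {e : Leaves T} {x : Option (Parents T) → ℂ[X][X]}
    (hx : leafIdeal lb e ≤ redKer x) (p : Amb T) :
    leafEval hx (Ideal.Quotient.mk _ p) = redH (MvPolynomial.aeval x p) := rfl

theorem leafEval_leafCoord {e : Leaves T} {x : Option (Parents T) → ℂ[X][X]}
    (hx : leafIdeal lb e ≤ redKer x) (p : ℂ[X]) :
    leafEval hx (leafCoord lb e p) = p.comp (redH (MvPolynomial.aeval x (xPar e.1))) := by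
  induction p using Polynomial.induction_on' with
  | add p q hp hq => rw [map_add, map_add, hp, hq, Polynomial.add_comp]
  | monomial n a =>
    have : algebraMap ℂ (Amb T ⧸ leafIdeal lb e) a = Ideal.Quotient.mk _ (const a) := rfl
    rw [← Polynomial.C_mul_X_pow_eq_monomial, map_mul, map_pow, leafCoord, Polynomial.aeval_C,
      Polynomial.aeval_X, this, map_mul, map_pow, leafEval_mk, leafEval_mk, aeval_const,
      redH_algebraMap]
    simp only [Polynomial.eval_C, Polynomial.mul_comp, Polynomial.C_comp, Polynomial.X_pow_comp]

/-- The map is the substitution `p ↦ p(a + b t)` with `b ≠ 0`. -/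
theorem leafEval_leafCoord_injective {e : Leaves T} {x : Option (Parents T) → ℂ[X][X]}
    (hx : IsChainSolution lb e.1 x) (hx' : leafIdeal lb e ≤ redKer x) :
    Function.Injective fun p => leafEval hx' (leafCoord lb e p) := by
  obtain ⟨a, b, hb, hab⟩ := hx.linear
  intro p q hpq
  simp only [leafEval_leafCoord, hab] at hpq
  rw [← sub_eq_zero, ← Polynomial.sub_comp, Polynomial.comp_eq_zero_iff, sub_eq_zero] at hpq
  refine hpq.resolve_right fun h => ?_
  have := congrArg (fun p => Polynomial.coeff p 1) h.2
  simp [hb] at this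

/-- On the chain of `e`, all variables but `X_{Par(e)}` are constants. A variable `X_d` off the
chain is reached by induction: if `d` and `e` branch at `m`, the simplified minor `Δ_{m,d}`
expresses an invertible multiple of `X_d` by `X_m` and by variables of ancestors of `d`. -/
theorem leafCoord_surjective (hlb : IsFine lb) (e : Leaves T) :
    Function.Surjective (leafCoord lb e) := by
  let mk := Ideal.Quotient.mk (leafIdeal lb e)
  have hconst (c : ℂ) : mk (const c) ∈ (leafCoord lb e).range := Subalgebra.algebraMap_mem _ c
  have hmem {p : Amb T} {c : ℂ} (h : p - const c ∈ leafIdeal lb e) :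
      mk p ∈ (leafCoord lb e).range := by
    rw [show mk p = mk (const c) from Ideal.Quotient.eq.2 h]
    exact hconst c
  have hC (p : ℂ[X]) : mk (MvPolynomial.C p) ∈ (leafCoord lb e).range := by
    refine hmem (c := p.eval 0) ?_
    obtain ⟨r, hr⟩ : Polynomial.X ∣ p - Polynomial.C (p.eval 0) := by
      simp [Polynomial.X_dvd_iff, Polynomial.coeff_zero_eq_eval_zero]
    rw [const, ← map_sub, hr, map_mul]
    exact Ideal.mul_mem_right _ _ (hVar_mem_nodeIdeal lb e.1)
  have hchain (f : T) (hf : f ≤ e.1) : mk (xPar f) ∈ (leafCoord lb e).range := by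
    rcases hf.eq_or_lt with rfl | hlt
    · exact ⟨Polynomial.X, Polynomial.aeval_X _⟩
    · obtain ⟨c, hc, hce⟩ := exists_covBy_le_of_lt hlt
      exact hmem (xPar_sub_const_mem lb hc hce)
  have hchain' (d : Parents T) (hd : d.1 < e.1) :
      mk (MvPolynomial.X (some d)) ∈ (leafCoord lb e).range := by
    obtain ⟨c, hc, hce⟩ := exists_covBy_le_of_lt hd
    have := hchain c hce
    rwa [xPar_of_covBy hc] at this
  have h0 : mk (MvPolynomial.X none) ∈ (leafCoord lb e).range := xPar_bot (T := T) ▸ hchain ⊥ bot_le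
  have hvar (d : Parents T) : mk (MvPolynomial.X (some d)) ∈ (leafCoord lb e).range := by
    induction d using WellFoundedLT.induction with
    | ind d ih =>
      by_cases hde : d.1 ≤ e.1
      · exact hchain' d (lt_of_le_of_ne hde fun h => d.2 (h ▸ e.2))
      have hbelow {p : Amb T} (hp : p ∈ below d.1) : mk p ∈ (leafCoord lb e).range := by
        refine Algebra.adjoin_induction (p := fun p _ => mk p ∈ (leafCoord lb e).range)
          ?_ hC (fun p q _ _ hp hq => ?_) (fun p q _ _ hp hq => ?_) hp
        · rintro _ ⟨o, ho, rfl⟩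
          cases o with
          | none => exact h0
          | some d' => exact ih d' (ho d' rfl)
        · rw [map_add]; exact add_mem hp hq
        · rw [map_mul]; exact mul_mem hp hq
      obtain ⟨m, g, f, hg, hf, hne, hgd, hfe⟩ := exists_covBy_ne hde
        fun h => d.2 (e.2.eq_of_le h ▸ e.2)
      obtain ⟨w, hw, hw'⟩ := exists_simplifiedMinor lb (d := ⟨m, fun hm => hm.not_lt hg.lt⟩) hg hgd
      have h1 : mk ((xPar m - const (lb g)) * MvPolynomial.X (some d)) =
          mk (w * MvPolynomial.X (some ⟨m, fun hm => hm.not_lt hg.lt⟩)) :=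
        Ideal.Quotient.eq.2 (idealI_le_nodeIdeal lb e.1 hw')
      have h2 : mk (xPar m) = mk (const (lb f)) :=
        Ideal.Quotient.eq.2 (xPar_sub_const_mem lb hf hfe)
      -- The coefficient of `X_d` in the simplified minor, evaluated on `C_e`.
      have hk : lb f - lb g ≠ 0 := sub_ne_zero.2 (hlb _ _ _ hf hg hne.symm)
      have h3 : mk (MvPolynomial.X (some d)) = mk (const (lb f - lb g)⁻¹) *
          mk (w * MvPolynomial.X (some ⟨m, fun hm => hm.not_lt hg.lt⟩)) := by
        rw [← h1, map_mul, map_sub, h2, ← map_sub, ← const_sub, ← mul_assoc, ← map_mul]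
        simp only [const, ← map_mul, inv_mul_cancel₀ hk, map_one, one_mul]
      rw [h3, map_mul]
      exact mul_mem (hconst _) (mul_mem (hbelow hw) (hchain' _ (hf.lt.trans_le hfe)))
  intro p
  obtain ⟨p, rfl⟩ := Ideal.Quotient.mk_surjective p
  change mk p ∈ (leafCoord lb e).range
  induction p using MvPolynomial.induction_on with
  | C p => exact hC p
  | add p q hp hq => rw [map_add]; exact add_mem hp hq
  | mul_X p o hp =>
    rw [map_mul]
    refine mul_mem hp ?_
    cases o with
    | none => exact h0
    | some d => exact hvar d

theorem leafCoord_bijective (hlb : IsFine lb) (e : Leaves T) :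
    Function.Bijective (leafCoord lb e) := by
  obtain ⟨x, hx, hx'⟩ := exists_isSolution_leaf hlb e
  exact ⟨fun p q h => leafEval_leafCoord_injective hx (leafIdeal_le_redKer e hx hx')
    (by simp only [h]), leafCoord_surjective hlb e⟩

/-- As `leafCoord` is onto and its composite with `leafEval` is injective, `leafEval` itself is
injective. -/
theorem redKer_le_leafIdeal (hlb : IsFine lb) (e : Leaves T) {x : Option (Parents T) → ℂ[X][X]}
    (hx : IsChainSolution lb e.1 x) (hx' : IsSolution lb x) : redKer x ≤ leafIdeal lb e := by
  intro p hp
  rw [← Ideal.Quotient.eq_zero_iff_mem]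
  obtain ⟨r, hr⟩ := leafCoord_surjective hlb e (Ideal.Quotient.mk _ p)
  have := leafEval_leafCoord_injective hx (leafIdeal_le_redKer e hx hx') (a₁ := r) (a₂ := 0)
    (by simp only [hr, map_zero]; exact hp)
  rw [← hr, this, map_zero]

/-- The `h`-torsion of `A[Γ] / I` vanishes modulo `h`. -/
theorem mem_of_pow_mul_mem (hlb : IsFine lb) {p : Amb T} {n : ℕ} (h : hVar ^ n * p ∈ idealI lb) :
    p ∈ idealI lb ⊔ Ideal.span {hVar} := by
  rw [← iInf_leafIdeal hlb, Ideal.mem_iInf]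
  intro e
  obtain ⟨x, hx, hx'⟩ := exists_isSolution_leaf hlb e
  refine redKer_le_leafIdeal hlb e hx hx' (mem_redKer.2 ?_)
  -- The solution annihilates `I` exactly, not only modulo `h`, and its values lie in a domain where
  -- `h ≠ 0`; so `p` itself evaluates to zero.
  have := RingHom.mem_ker.1 (hx'.idealI_le_ker_of_natDegree_pos (by simp) hx.deg h)
  rw [map_mul, map_pow, aeval_hVar, mul_eq_zero] at this
  rw [this.resolve_left (pow_ne_zero _ (by simp [Polynomial.algebraMap_eq])), map_zero]

end Curves

section Commutative

/-! ### Commutative algebra along a nonzero nonunit -/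

/-- An element killed by `h` is divisible by every power of `h`, by repeated use of `H`. In a
Noetherian ring the kernel and the image of `h ^ n` meet trivially for large `n`. -/
theorem mem_nonZeroDivisors_of_torsion_le {B : Type*} [CommRing B] [IsNoetherianRing B] {h : B}
    (H : ∀ (b : B) (n : ℕ), h ^ n * b = 0 → b ∈ Ideal.span {h}) : h ∈ nonZeroDivisors B := by
  obtain ⟨n, hn, hn1⟩ := ((Module.End.eventually_disjoint_ker_pow_range_pow
    (LinearMap.mulLeft B h)).and (Filter.eventually_ge_atTop 1)).exists
  have key (k : ℕ) : ∀ b, h * b = 0 → ∃ c, b = h ^ k * c := by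
    intro b hb
    induction k with
    | zero => exact ⟨b, by simp⟩
    | succ k ih =>
      obtain ⟨c, rfl⟩ := ih
      obtain ⟨d, rfl⟩ := Ideal.mem_span_singleton'.1
        (H c (k + 1) (by rw [pow_succ', mul_assoc, hb]))
      exact ⟨d, by ring⟩
  refine mem_nonZeroDivisors_iff_right.2 fun b hb => ?_
  rw [mul_comm] at hb
  have hpow (c : B) : ((LinearMap.mulLeft B h : Module.End B B) ^ n) c = h ^ n * c := by
    rw [LinearMap.pow_mulLeft, LinearMap.mulLeft_apply]
  refine Submodule.disjoint_def.1 hn b ?_ ?_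
  · obtain ⟨m, rfl⟩ := Nat.exists_eq_succ_of_ne_zero (Nat.one_le_iff_ne_zero.1 hn1)
    rw [LinearMap.mem_ker, hpow, pow_succ, mul_assoc, hb, mul_zero]
  · obtain ⟨c, rfl⟩ := key n b hb
    exact ⟨c, hpow c⟩

/-- An integral element lies in `L`, hence has the form `b / h ^ n`. If `n > 0`, its integral
equation with denominators cleared puts a power of `b` into `(h)`; radicality then gives `b ∈ (h)`,
and `n` drops by one. -/
theorem isIntegrallyClosed_of_isLocalization_away {B L : Type*} [CommRing B] [IsDomain B]
    [CommRing L] [IsDomain L] [Algebra B L] {h : B} (h0 : h ≠ 0) [IsLocalization.Away h L]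
    [IsIntegrallyClosed L] (hrad : (Ideal.span {h}).IsRadical) : IsIntegrallyClosed B := by
  let K := FractionRing B
  have hle : Submonoid.powers h ≤ nonZeroDivisors B :=
    powers_le_nonZeroDivisors_of_noZeroDivisors h0
  let f : L →+* K := IsLocalization.lift (M := Submonoid.powers h) (g := algebraMap B K)
    fun y => IsLocalization.map_units K (⟨y, hle y.2⟩ : nonZeroDivisors B)
  let _ : Algebra L K := f.toAlgebra
  have _ : IsScalarTower B L K := .of_algebraMap_eq' (IsLocalization.lift_comp _).symm
  have hK : IsFractionRing L K := IsFractionRing.isFractionRing_of_isDomain_of_isLocalization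
    (Submonoid.powers h) L K
  refine (isIntegrallyClosed_iff K).2 fun {x} hx => ?_
  obtain ⟨l, rfl⟩ := (isIntegrallyClosed_iff K).1 ‹IsIntegrallyClosed L› hx.tower_top
  obtain ⟨n, b, hb⟩ := IsLocalization.Away.surj h l
  replace hb : algebraMap B K (h ^ n) * algebraMap L K l = algebraMap B K b := by
    rw [IsScalarTower.algebraMap_apply B L K, IsScalarTower.algebraMap_apply B L K, ← hb, map_mul,
      map_pow, mul_comm]
  generalize algebraMap L K l = x at hx hb
  obtain ⟨P, hP, hPx⟩ := hx
  induction n generalizing b with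
  | zero => exact ⟨b, by rw [← hb]; simp⟩
  | succ n ih =>
    have hmem : b ^ P.natDegree ∈ Ideal.span {h} := by
      have hroot : Polynomial.aeval b (P.scaleRoots (h ^ (n + 1))) = 0 := by
        have := Polynomial.scaleRoots_aeval_eq_zero (A := K) (r := h ^ (n + 1)) hPx
        rw [hb, Polynomial.aeval_algebraMap_apply] at this
        exact IsFractionRing.injective B K (this.trans (map_zero _).symm)
      -- Every coefficient below the leading one has acquired a factor `h`.
      have hmap : (P.scaleRoots (h ^ (n + 1))).map (Ideal.Quotient.mk (Ideal.span {h})) =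
          Polynomial.X ^ P.natDegree := by
        ext i
        rw [Polynomial.coeff_map, Polynomial.coeff_scaleRoots, Polynomial.coeff_X_pow]
        split_ifs with hi
        · rw [hi, hP.coeff_natDegree]
          simp
        · rw [Ideal.Quotient.eq_zero_iff_mem]
          rcases lt_or_gt_of_ne hi with hi | hi
          · refine Ideal.mul_mem_left _ _ (Ideal.mem_span_singleton.2 ?_)
            exact (dvd_pow_self h n.succ_ne_zero).trans (dvd_pow_self _ (Nat.sub_ne_zero_of_lt hi))
          · rw [Polynomial.coeff_eq_zero_of_natDegree_lt hi, zero_mul]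
            exact zero_mem _
      have := congrArg (Polynomial.eval (Ideal.Quotient.mk (Ideal.span {h}) b)) hmap
      rw [Polynomial.eval_map, Polynomial.eval₂_hom, Polynomial.eval_pow, Polynomial.eval_X,
        ← Polynomial.coe_aeval_eq_eval, hroot, map_zero, ← map_pow] at this
      exact Ideal.Quotient.eq_zero_iff_mem.1 this.symm
    obtain ⟨c, rfl⟩ := Ideal.mem_span_singleton.1 (hrad ⟨_, hmem⟩)
    refine ih c ?_
    have hh : algebraMap B K h ≠ 0 := by
      rwa [Ne, FaithfulSMul.algebraMap_eq_zero_iff]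
    refine mul_left_cancel₀ hh ?_
    rw [← map_mul, ← hb, ← mul_assoc, ← map_mul, ← pow_succ']

/-- The element `s` is `1` modulo `K i` and lies in every other `K j`. It becomes a unit at `p`,
where `K i` therefore coincides with the whole intersection. -/
theorem exists_inverse_mod_iInf {B ι : Type*} [CommRing B] [Fintype ι] {K : ι → Ideal B}
    (hK : Pairwise fun i j => IsCoprime (K i) (K j)) (i : ι) {p : Ideal B} (hp : p ≠ ⊤)
    (hip : K i ≤ p) : ∃ s ∉ p, ∀ k ∈ K i, s * k ∈ ⨅ j, K j := by
  classical
  have := Ideal.isCoprime_biInf (I := K i) (J := K) (s := Finset.univ.erase i)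
    fun j hj => hK (Finset.ne_of_mem_erase hj).symm
  obtain ⟨a, ha, s, hs, has⟩ := Ideal.isCoprime_iff_exists.1 this
  refine ⟨s, fun hsp => hp ?_, fun k hk => Ideal.mem_iInf.2 fun j => ?_⟩
  · rw [Ideal.eq_top_iff_one, ← has]
    exact add_mem (hip ha) hsp
  · by_cases hj : j = i
    · subst hj
      exact Ideal.mul_mem_left _ _ hk
    · simp only [Ideal.mem_iInf] at hs
      exact Ideal.mul_mem_right _ _ (hs j (Finset.mem_erase.2 ⟨hj, Finset.mem_univ j⟩))

/-! ### Local rings at primes containing `h` -/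

section Fiber

variable {B ι : Type*} [CommRing B] [IsDomain B] [Fintype ι] {D : ι → Type*}
  [∀ i, CommRing (D i)] [∀ i, IsDomain (D i)] [∀ i, IsPrincipalIdealRing (D i)] {h : B}
  {θ : ∀ i, B →+* D i}

theorem exists_ker_le (hinf : ⨅ i, RingHom.ker (θ i) = Ideal.span {h}) (p : Ideal B)
    [hp : p.IsPrime] (hhp : h ∈ p) : ∃ i, RingHom.ker (θ i) ≤ p := by
  have : (Finset.univ.inf fun i => RingHom.ker (θ i)) ≤ p := by
    rw [Finset.inf_univ_eq_iInf, hinf]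
    exact (Ideal.span_singleton_le_iff_mem _).2 hhp
  obtain ⟨i, -, hi⟩ := (Ideal.IsPrime.inf_le' hp).1 this
  exact ⟨i, hi⟩

/-- Locally at `p` the kernel of `θ i` is generated by `h`, and `p` modulo this kernel is principal
with generator `g`. The last clause leaves the single generator `h` at the generic point of a
component, where height one is all that is available. -/
theorem exists_maximalIdeal_eq (hθ : ∀ i, Function.Surjective (θ i))
    (hco : Pairwise fun i j => IsCoprime (RingHom.ker (θ i)) (RingHom.ker (θ j)))
    (hinf : ⨅ i, RingHom.ker (θ i) = Ideal.span {h}) (p : Ideal B) [hp : p.IsPrime] (i : ι)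
    (hi : RingHom.ker (θ i) ≤ p) :
    ∃ g : B, IsLocalRing.maximalIdeal (Localization.AtPrime p) =
      Ideal.span {algebraMap B _ h, algebraMap B _ g} ∧ (p = RingHom.ker (θ i) → g = 0) := by
  obtain ⟨g', hg'⟩ := IsPrincipalIdealRing.principal (p.map (θ i))
  obtain ⟨g, hg, hg0⟩ : ∃ g, θ i g = g' ∧ (p = RingHom.ker (θ i) → g = 0) := by
    by_cases h0 : p = RingHom.ker (θ i)
    · refine ⟨0, ?_, fun _ => rfl⟩
      have h1 : p.map (θ i) = ⊥ := (Ideal.map_eq_bot_iff_le_ker _).2 h0.le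
      rw [h1] at hg'
      have h2 : g' ∈ (⊥ : Ideal (D i)) := hg' ▸ Ideal.subset_span rfl
      rw [map_zero, Ideal.mem_bot.1 h2]
    · obtain ⟨g, hg⟩ := hθ i g'
      exact ⟨g, hg, fun h => absurd h h0⟩
  have hmap : p = Ideal.span {g} ⊔ RingHom.ker (θ i) := by
    rw [← Ideal.comap_map_of_surjective' _ (hθ i), Ideal.map_span, Set.image_singleton, hg]
    rw [Ideal.span, ← hg', Ideal.comap_map_of_surjective' _ (hθ i), sup_eq_left.2 hi]
  refine ⟨g, ?_, hg0⟩
  obtain ⟨s, hs, hsk⟩ := exists_inverse_mod_iInf hco i hp.ne_top hi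
  rw [← Localization.AtPrime.map_eq_maximalIdeal]
  apply le_antisymm
  · have h1 := congrArg (Ideal.map (algebraMap B (Localization.AtPrime p))) hmap
    rw [Ideal.map_sup, Ideal.map_span, Set.image_singleton] at h1
    rw [h1]
    refine sup_le (Ideal.span_mono (by simp)) (Ideal.map_le_iff_le_comap.2 fun k hk => ?_)
    have hsu : IsUnit (algebraMap B (Localization.AtPrime p) s) :=
      IsLocalization.map_units _ (⟨s, hs⟩ : p.primeCompl)
    rw [Ideal.mem_comap, ← Ideal.unit_mul_mem_iff_mem _ hsu, ← map_mul]
    have := hsk k hk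
    rw [hinf] at this
    obtain ⟨c, hc⟩ := Ideal.mem_span_singleton'.1 this
    rw [← hc, map_mul]
    exact Ideal.mul_mem_left _ _ (Ideal.subset_span (by simp))
  · refine Ideal.span_le.2 ?_
    have hh : h ∈ p := hi ((iInf_le (fun i => RingHom.ker (θ i)) i) (hinf ▸ Ideal.subset_span rfl))
    have hgp : g ∈ p := hmap ▸ Ideal.mem_sup_left (Ideal.subset_span rfl)
    rintro _ (rfl | rfl)
    · exact Ideal.mem_map_of_mem _ hh
    · exact Ideal.mem_map_of_mem _ hgp

theorem one_le_height_ker (h0 : h ≠ 0) (hinf : ⨅ i, RingHom.ker (θ i) = Ideal.span {h}) (i : ι) :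
    1 ≤ (RingHom.ker (θ i)).height := by
  have hh : h ∈ RingHom.ker (θ i) :=
    (iInf_le (fun i => RingHom.ker (θ i)) i) (hinf ▸ Ideal.subset_span rfl)
  have hlt : (⊥ : Ideal B) < RingHom.ker (θ i) :=
    bot_lt_iff_ne_bot.2 fun hb => h0 (by simpa [hb] using hh)
  have : (RingHom.ker (θ i)).IsPrime := RingHom.ker_isPrime _
  exact le_add_self.trans (Ideal.height_add_one_le_of_lt_of_isPrime hlt)

theorem two_le_height (h0 : h ≠ 0) (hinf : ⨅ i, RingHom.ker (θ i) = Ideal.span {h}) {i : ι}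
    {p : Ideal B} [p.IsPrime] (hp : RingHom.ker (θ i) < p) : 2 ≤ p.height := by
  have : (RingHom.ker (θ i)).IsPrime := RingHom.ker_isPrime _
  refine le_trans ?_ (Ideal.height_add_one_le_of_lt_of_isPrime hp)
  rw [← one_add_one_eq_two]
  exact add_le_add_left (one_le_height_ker h0 hinf i) 1

variable [IsNoetherianRing B]

theorem spanFinrank_maximalIdeal_le (hθ : ∀ i, Function.Surjective (θ i))
    (hco : Pairwise fun i j => IsCoprime (RingHom.ker (θ i)) (RingHom.ker (θ j)))
    (hinf : ⨅ i, RingHom.ker (θ i) = Ideal.span {h}) (p : Ideal B) [p.IsPrime] (hhp : h ∈ p) :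
    (IsLocalRing.maximalIdeal (Localization.AtPrime p)).spanFinrank ≤ 2 := by
  obtain ⟨i, hi⟩ := exists_ker_le hinf p hhp
  obtain ⟨g, hg, -⟩ := exists_maximalIdeal_eq hθ hco hinf p i hi
  rw [hg]
  exact (Submodule.spanFinrank_span_le_ncard_of_finite (Set.toFinite _)).trans
    ((Set.ncard_insert_le _ _).trans (by rw [Set.ncard_singleton]))

theorem height_le_two (hθ : ∀ i, Function.Surjective (θ i))
    (hco : Pairwise fun i j => IsCoprime (RingHom.ker (θ i)) (RingHom.ker (θ j)))
    (hinf : ⨅ i, RingHom.ker (θ i) = Ideal.span {h}) (p : Ideal B) [p.IsPrime] (hhp : h ∈ p) :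
    p.height ≤ 2 := by
  have h1 := ringKrullDim_le_spanFinrank_maximalIdeal (Localization.AtPrime p)
  rw [IsLocalization.AtPrime.ringKrullDim_eq_height p (Localization.AtPrime p)] at h1
  have h2 := spanFinrank_maximalIdeal_le hθ hco hinf p hhp
  exact WithBot.coe_le_coe.1 (h1.trans (Nat.cast_le.2 h2))

/-- The number of generators is matched by the chain `⊥ < ker (θ i)`, prolonged by `p` when `p` is
strictly larger. -/
theorem isRegularLocalRing_of_mem (h0 : h ≠ 0) (hθ : ∀ i, Function.Surjective (θ i))
    (hco : Pairwise fun i j => IsCoprime (RingHom.ker (θ i)) (RingHom.ker (θ j)))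
    (hinf : ⨅ i, RingHom.ker (θ i) = Ideal.span {h}) (p : Ideal B) [p.IsPrime] (hhp : h ∈ p) :
    IsRegularLocalRing (Localization.AtPrime p) := by
  apply IsRegularLocalRing.of_spanFinrank_maximalIdeal_le
  rw [IsLocalization.AtPrime.ringKrullDim_eq_height p (Localization.AtPrime p)]
  obtain ⟨i, hi⟩ := exists_ker_le hinf p hhp
  obtain ⟨g, hg, hg0⟩ := exists_maximalIdeal_eq hθ hco hinf p i hi
  rcases hi.eq_or_lt with heq | hlt
  · rw [hg0 heq.symm, map_zero, Set.pair_comm, Ideal.span_insert_zero] at hg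
    rw [hg]
    have h1 := heq ▸ one_le_height_ker h0 hinf i
    have h2 := Submodule.spanFinrank_span_le_ncard_of_finite (R := Localization.AtPrime p)
      (Set.toFinite {algebraMap B (Localization.AtPrime p) h})
    rw [Set.ncard_singleton] at h2
    exact le_trans (Nat.cast_le.2 h2) (by exact_mod_cast h1)
  · have h1 := two_le_height h0 hinf hlt
    exact le_trans (Nat.cast_le.2 (spanFinrank_maximalIdeal_le hθ hco hinf p hhp))
      (WithBot.coe_le_coe.2 h1)

end Fiber

/-! ### Local rings at primes not containing `h` -/

section Away

variable {B L : Type*} [CommRing B] [CommRing L] [Algebra B L] {h : B} [IsLocalization.Away h L]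
  (p : Ideal B) [hp : p.IsPrime]

theorem disjoint_powers_of_notMem (hhp : h ∉ p) :
    Disjoint (Submonoid.powers h : Set B) (p : Set B) := by
  rw [Set.disjoint_left]
  rintro _ ⟨n, rfl⟩ hn
  exact hhp (hp.mem_of_pow_mem n hn)

theorem isRegularLocalRing_of_notMem [IsRegularRing L] (hhp : h ∉ p) :
    IsRegularLocalRing (Localization.AtPrime p) := by
  have hd := disjoint_powers_of_notMem p hhp
  let q := p.map (algebraMap B L)
  have : q.IsPrime := IsLocalization.isPrime_of_isPrime_disjoint (Submonoid.powers h) _ _ hp hd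
  have : IsLocalization.AtPrime (Localization.AtPrime q) p := by
    convert IsLocalization.isLocalization_isLocalization_atPrime_isLocalization
      (Submonoid.powers h) (Localization.AtPrime q) q
    exact (IsLocalization.under_map_of_isPrime_disjoint (Submonoid.powers h) _ hp hd).symm
  exact IsRegularLocalRing.of_ringEquiv (IsLocalization.algEquiv p.primeCompl
    (Localization.AtPrime q) (Localization.AtPrime p)).toRingEquiv

theorem height_le_ringKrullDim_away (hhp : h ∉ p) :
    (p.height : WithBot ℕ∞) ≤ ringKrullDim L := by
  have hd := disjoint_powers_of_notMem p hhp
  let q := p.map (algebraMap B L)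
  have : q.IsPrime := IsLocalization.isPrime_of_isPrime_disjoint (Submonoid.powers h) _ _ hp hd
  have h1 := IsLocalization.height_under (Submonoid.powers h) q
  rw [IsLocalization.under_map_of_isPrime_disjoint (Submonoid.powers h) _ hp hd] at h1
  rw [h1]
  exact Ideal.height_le_ringKrullDim_of_isPrime

end Away

/-- The coordinate ring of the punctured line. -/
abbrev Ah : Type := Localization.Away (Polynomial.X : ℂ[X])

theorem powers_X_le : Submonoid.powers (Polynomial.X : ℂ[X]) ≤ nonZeroDivisors ℂ[X] :=
  powers_le_nonZeroDivisors_of_noZeroDivisors Polynomial.X_ne_zero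

instance isDomain_Ah : IsDomain Ah :=
  IsLocalization.isDomain_localization powers_X_le

instance isDedekindDomain_Ah : IsDedekindDomain Ah :=
  IsLocalization.isDedekindDomain ℂ[X] powers_X_le Ah

theorem ringKrullDim_Ah_polynomial_le : ringKrullDim Ah[X] ≤ 2 := by
  have h : ringKrullDim Ah ≤ 1 := by
    refine (ringKrullDim_le_iff_height_le _).2 fun p hp => ?_
    rw [← IsLocalization.height_under (Submonoid.powers (Polynomial.X : ℂ[X])) p]
    refine Ideal.height_le_ringKrullDim_of_isPrime.trans ?_
    rw [Polynomial.ringKrullDim_of_isNoetherianRing, ringKrullDim_eq_zero_of_field, zero_add]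
  rw [Polynomial.ringKrullDim_of_isNoetherianRing, ← one_add_one_eq_two]
  gcongr

theorem algebraMap_X_Ah_ne_zero : algebraMap ℂ[X] Ah Polynomial.X ≠ 0 :=
  (IsLocalization.Away.algebraMap_isUnit (S := Ah) (Polynomial.X : ℂ[X])).ne_zero

end Commutative

/-! ### The coordinate ring of the surface -/

section CoordinateRing

variable {T : RootedTree.{0}} [Fintype T] (lb : T → ℂ)

/-- The ring `B`, with its quotient presentation hidden. -/
def CoordRing : Type := B lb

instance commRing_CoordRing : CommRing (CoordRing lb) := inferInstanceAs (CommRing (B lb))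

instance algebra_CoordRing : Algebra ℂ[X] (CoordRing lb) := inferInstanceAs (Algebra ℂ[X] (B lb))

/-- The quotient map `A[Γ] → B`. -/
def toB : Amb T →ₐ[ℂ[X]] CoordRing lb := Ideal.Quotient.mkₐ ℂ[X] (idealI lb)

theorem toB_surjective : Function.Surjective (toB lb) := Ideal.Quotient.mk_surjective

variable {lb} in
theorem toB_eq_zero_iff {p : Amb T} : toB lb p = 0 ↔ p ∈ idealI lb :=
  Ideal.Quotient.eq_zero_iff_mem

/-- The coordinate ring of `C_e`, with its quotient presentation hidden. -/
def LeafRing (e : Leaves T) : Type := Amb T ⧸ leafIdeal lb e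

instance commRing_LeafRing (e : Leaves T) : CommRing (LeafRing lb e) :=
  inferInstanceAs (CommRing (Amb T ⧸ leafIdeal lb e))

/-- The quotient map from `A[Γ]` onto the coordinate ring of `C_e`. -/
def mkLeaf (e : Leaves T) : Amb T →+* LeafRing lb e := Ideal.Quotient.mk (leafIdeal lb e)

variable {lb} in
theorem mkLeaf_eq_zero_iff {e : Leaves T} {p : Amb T} :
    mkLeaf lb e p = 0 ↔ p ∈ leafIdeal lb e :=
  Ideal.Quotient.eq_zero_iff_mem

/-! ### The ring `B` after inverting `h` -/

/-- The variables of `A[Γ]` as polynomials in `X₀` over `ℂ[h, h⁻¹]`. -/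
def genericSol : Option (Parents T) → Ah[X] :=
  (exists_assignment lb (fun p : Ah[X] =>
    Polynomial.C (IsLocalization.Away.invSelf (Polynomial.X : ℂ[X])) * p) Polynomial.X).choose

theorem genericSol_none : genericSol lb none = Polynomial.X :=
  (exists_assignment lb _ _).choose_spec.1

theorem isSolution_genericSol : IsSolution lb (genericSol lb) := fun e => by
  have h : genericSol lb (some e) = Polynomial.C (IsLocalization.Away.invSelf
      (Polynomial.X : ℂ[X])) * MvPolynomial.aeval (genericSol lb) (qPoly lb e.1) :=
    (exists_assignment lb (fun p : Ah[X] =>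
      Polynomial.C (IsLocalization.Away.invSelf (Polynomial.X : ℂ[X])) * p)
      Polynomial.X).choose_spec.2 e
  rw [h, ← mul_assoc, algebraMap_polynomial_X, ← Polynomial.C_mul, IsLocalization.Away.mul_invSelf,
    Polynomial.C_1, one_mul]

/-- The localization map from `B` to `ℂ[h, h⁻¹][X₀]`. -/
def toL : CoordRing lb →ₐ[ℂ[X]] Ah[X] :=
  Ideal.Quotient.liftₐ (idealI lb) (MvPolynomial.aeval (genericSol lb)) fun _ hp =>
    (isSolution_genericSol lb).idealI_le_ker_of_natDegree_pos algebraMap_X_Ah_ne_zero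
      (by simp [genericSol_none]) hp

theorem toL_mk (p : Amb T) : toL lb (toB lb p) =
    MvPolynomial.aeval (genericSol lb) p := rfl

instance algebraL : Algebra (CoordRing lb) Ah[X] := (toL lb).toRingHom.toAlgebra

theorem algebraMap_L (b : CoordRing lb) : algebraMap (CoordRing lb) Ah[X] b = toL lb b := rfl

instance isScalarTower_L : IsScalarTower ℂ[X] (CoordRing lb) Ah[X] :=
  .of_algebraMap_eq fun p => ((toL lb).commutes p).symm

/-- The element `h` of `B`. -/
abbrev hB : CoordRing lb := algebraMap ℂ[X] (CoordRing lb) Polynomial.X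

theorem toB_hVar : toB lb hVar = hB lb := (toB lb).commutes _

/-- The candidate for the inverse of `B[1/h] → ℂ[h, h⁻¹][X₀]`. -/
def ofL : Ah[X] →+* Localization.Away (hB lb) :=
  Polynomial.eval₂RingHom (IsLocalization.Away.lift (Polynomial.X : ℂ[X])
    (g := algebraMap ℂ[X] (Localization.Away (hB lb)))
    (by
      rw [IsScalarTower.algebraMap_apply ℂ[X] (CoordRing lb)]
      exact IsLocalization.Away.algebraMap_isUnit _))
    (algebraMap (CoordRing lb) _ (toB lb (MvPolynomial.X none)))

theorem ofL_algebraMap (p : ℂ[X]) :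
    ofL lb (algebraMap ℂ[X] Ah[X] p) = algebraMap ℂ[X] (Localization.Away (hB lb)) p := by
  rw [ofL, Polynomial.algebraMap_apply, Polynomial.coe_eval₂RingHom, Polynomial.eval₂_C,
    IsLocalization.Away.lift_eq]

/-- Both maps to `B[1/h]` agree on `X₀`. They satisfy the same equations `h X_e = Q_e` with `h` a
unit, so they agree on each `X_e` by induction along the tree. -/
theorem ofL_toL (b : CoordRing lb) : ofL lb (toL lb b) = algebraMap (CoordRing lb) (Localization.Away (hB lb)) b := by
  obtain ⟨p, rfl⟩ := toB_surjective lb b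
  rw [toL_mk]
  let _ : Algebra Ah[X] (Localization.Away (hB lb)) := (ofL lb).toAlgebra
  have _ : IsScalarTower ℂ[X] Ah[X] (Localization.Away (hB lb)) :=
    .of_algebraMap_eq fun p => (ofL_algebraMap lb p).symm
  have hu : IsUnit (algebraMap (CoordRing lb) (Localization.Away (hB lb)) (hB lb)) :=
    IsLocalization.Away.algebraMap_isUnit _
  let F : Amb T →ₐ[ℂ[X]] Localization.Away (hB lb) :=
    (IsScalarTower.toAlgHom ℂ[X] Ah[X] _).comp (MvPolynomial.aeval (genericSol lb))
  let G : Amb T →ₐ[ℂ[X]] Localization.Away (hB lb) :=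
    (IsScalarTower.toAlgHom ℂ[X] (CoordRing lb) _).comp (toB lb)
  suffices h : F = G from DFunLike.congr_fun h p
  have hF (q : Amb T) : F q = MvPolynomial.aeval (fun o => F (MvPolynomial.X o)) q :=
    DFunLike.congr_fun (MvPolynomial.aeval_unique F) q
  have hG (q : Amb T) : G q = MvPolynomial.aeval (fun o => G (MvPolynomial.X o)) q :=
    DFunLike.congr_fun (MvPolynomial.aeval_unique G) q
  have hnone : F (MvPolynomial.X none) = G (MvPolynomial.X none) := by
    change ofL lb (MvPolynomial.aeval _ _) = _
    rw [MvPolynomial.aeval_X, genericSol_none, ofL, Polynomial.coe_eval₂RingHom,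
      Polynomial.eval₂_X]
    rfl
  refine MvPolynomial.algHom_ext fun o => ?_
  cases o with
  | none => exact hnone
  | some e =>
    induction e using WellFoundedLT.induction with
    | ind e ih =>
      refine hu.mul_left_cancel ?_
      have h1 : F (hVar * MvPolynomial.X (some e)) = F (qPoly lb e.1) := by
        have : MvPolynomial.aeval (genericSol lb) (hVar * MvPolynomial.X (some e)) =
            MvPolynomial.aeval (genericSol lb) (qPoly lb e.1) := by
          rw [map_mul, aeval_hVar, MvPolynomial.aeval_X]
          exact isSolution_genericSol lb e
        exact congrArg (ofL lb) this
      have h2 : G (hVar * MvPolynomial.X (some e)) = G (qPoly lb e.1) := by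
        have : toB lb (hVar * MvPolynomial.X (some e)) = toB lb (qPoly lb e.1) := by
          rw [← sub_eq_zero, ← map_sub, toB_eq_zero_iff]
          exact hVar_mul_sub_qPoly_mem lb e
        exact congrArg (algebraMap (CoordRing lb) _) this
      have h3 : F (qPoly lb e.1) = G (qPoly lb e.1) := by
        rw [hF, hG]
        exact aeval_congr_of_mem_below hnone (fun d hd => ih d hd) (qPoly_mem_below lb e.1)
      have h4 : F hVar = algebraMap (CoordRing lb) (Localization.Away (hB lb)) (hB lb) := by
        rw [← IsScalarTower.algebraMap_apply ℂ[X] (CoordRing lb)]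
        exact F.commutes _
      have h5 : G hVar = algebraMap (CoordRing lb) (Localization.Away (hB lb)) (hB lb) := rfl
      rw [map_mul, h4] at h1
      rw [map_mul, h5] at h2
      rw [h1, h2, h3]

theorem toL_hB : toL lb (hB lb) = algebraMap ℂ[X] Ah[X] Polynomial.X := (toL lb).commutes _

/-- Fractions exist because `X₀` comes from `B` and the coefficients only have powers of `h` as
denominators. Elements identified by `toL` are identified in `B[1/h]`, thanks to `ofL_toL`. -/
instance isLocalization_L : IsLocalization.Away (hB lb) Ah[X] where
  map_units := by
    rintro ⟨_, n, rfl⟩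
    rw [algebraMap_L, map_pow, toL_hB, algebraMap_polynomial_X]
    exact ((IsLocalization.Away.algebraMap_isUnit (S := Ah) _).map Polynomial.C).pow n
  surj p := by
    suffices ∃ (n : ℕ) (b : CoordRing lb), p * toL lb (hB lb) ^ n = toL lb b by
      obtain ⟨n, b, h⟩ := this
      exact ⟨⟨b, ⟨_, n, rfl⟩⟩, by rw [algebraMap_L, algebraMap_L, ← h, map_pow]⟩
    induction p using Polynomial.induction_on' with
    | add p q hp hq =>
      obtain ⟨n, b, hb⟩ := hp
      obtain ⟨m, c, hc⟩ := hq
      refine ⟨n + m, b * hB lb ^ m + c * hB lb ^ n, ?_⟩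
      rw [map_add, map_mul, map_mul, ← hb, ← hc, map_pow, map_pow]
      ring
    | monomial k a =>
      obtain ⟨n, r, hr⟩ := IsLocalization.Away.surj (Polynomial.X : ℂ[X]) a
      refine ⟨n, algebraMap ℂ[X] (CoordRing lb) r * toB lb (MvPolynomial.X none) ^ k, ?_⟩
      rw [map_mul, map_pow, toL_mk, MvPolynomial.aeval_X, genericSol_none, AlgHom.commutes,
        AlgHom.commutes, show algebraMap ℂ[X] Ah[X] r = Polynomial.C (algebraMap ℂ[X] Ah r) from rfl,
        ← hr, ← Polynomial.C_mul_X_pow_eq_monomial, algebraMap_polynomial_X]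
      simp only [map_mul, map_pow]
      ring
  exists_of_eq {b c} h := by
    have := congrArg (ofL lb) h
    rw [algebraMap_L, algebraMap_L, ofL_toL, ofL_toL] at this
    exact IsLocalization.exists_of_eq this

/-! ### The ring `B` is a normal domain with regular local rings -/

instance isNoetherianRing_B : IsNoetherianRing (CoordRing lb) :=
  isNoetherianRing_of_surjective _ _ (toB lb).toRingHom (toB_surjective lb)

variable {lb}

theorem toB_mem_span_iff {p : Amb T} :
    toB lb p ∈ Ideal.span {hB lb} ↔ p ∈ idealI lb ⊔ Ideal.span {hVar} := by
  rw [Ideal.mem_span_singleton', sup_comm, Ideal.mem_span_singleton_sup]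
  constructor
  · rintro ⟨c, hc⟩
    obtain ⟨r, rfl⟩ := toB_surjective lb c
    refine ⟨r, p - r * hVar, ?_, add_sub_cancel _ _⟩
    rw [← toB_eq_zero_iff, map_sub, map_mul, toB_hVar, hc, sub_self]
  · rintro ⟨r, i, hi, rfl⟩
    exact ⟨toB lb r, by rw [map_add, map_mul, toB_hVar, toB_eq_zero_iff.2 hi, add_zero]⟩

theorem hB_mem_nonZeroDivisors (hlb : IsFine lb) : hB lb ∈ nonZeroDivisors (CoordRing lb) := by
  refine mem_nonZeroDivisors_of_torsion_le fun b n hb => ?_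
  obtain ⟨p, rfl⟩ := toB_surjective lb b
  rw [← toB_hVar, ← map_pow, ← map_mul, toB_eq_zero_iff] at hb
  exact toB_mem_span_iff.2 (mem_of_pow_mul_mem hlb hb)

theorem toL_injective (hlb : IsFine lb) : Function.Injective (toL lb) :=
  IsLocalization.injective Ah[X] (M := Submonoid.powers (hB lb))
    (Submonoid.powers_le.2 (hB_mem_nonZeroDivisors hlb))

theorem isDomain_B (hlb : IsFine lb) : IsDomain (CoordRing lb) :=
  (toL_injective hlb).isDomain (toL lb).toRingHom

theorem hB_ne_zero (hlb : IsFine lb) : hB lb ≠ 0 :=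
  have := isDomain_B hlb
  nonZeroDivisors.ne_zero (hB_mem_nonZeroDivisors hlb)

/-- A domain containing the principal ideal domain `ℂ[h]` is torsion-free over it, hence flat. -/
theorem flat_B (hlb : IsFine lb) : Module.Flat ℂ[X] (CoordRing lb) := by
  have := isDomain_B hlb
  have : FaithfulSMul ℂ[X] (CoordRing lb) := by
    refine (faithfulSMul_iff_algebraMap_injective ℂ[X] (CoordRing lb)).2 ?_
    refine Function.Injective.of_comp (f := toL lb) ?_
    have h : Function.Injective (algebraMap ℂ[X] Ah[X]) := by
      rw [IsScalarTower.algebraMap_eq ℂ[X] Ah Ah[X]]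
      exact Polynomial.C_injective.comp (IsLocalization.injective Ah powers_X_le)
    rwa [show toL lb ∘ algebraMap ℂ[X] (CoordRing lb) = algebraMap ℂ[X] Ah[X] from
      funext (toL lb).commutes]
  infer_instance

/-- The quotient map onto the coordinate ring of `C_e`. -/
def toLeaf (lb : T → ℂ) (e : Leaves T) : CoordRing lb →+* (LeafRing lb e) :=
  Ideal.Quotient.factor (le_sup_left : idealI lb ≤ leafIdeal lb e)

theorem toLeaf_toB (lb : T → ℂ) (e : Leaves T) (p : Amb T) :
    toLeaf lb e (toB lb p) = mkLeaf lb e p := rfl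

theorem toLeaf_surjective (e : Leaves T) : Function.Surjective (toLeaf lb e) :=
  Ideal.Quotient.factor_surjective (le_sup_left : idealI lb ≤ leafIdeal lb e)

theorem mem_ker_toLeaf {e : Leaves T} {p : Amb T} :
    toB lb p ∈ RingHom.ker (toLeaf lb e) ↔ p ∈ leafIdeal lb e := by
  rw [RingHom.mem_ker, toLeaf_toB, mkLeaf_eq_zero_iff]

theorem isCoprime_ker_toLeaf (hlb : IsFine lb) :
    _root_.Pairwise fun e e' =>
      IsCoprime (RingHom.ker (toLeaf lb e)) (RingHom.ker (toLeaf lb e')) := by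
  intro e e' h
  obtain ⟨a, ha, b, hb, hab⟩ := Ideal.isCoprime_iff_exists.1 (isCoprime_leafIdeal hlb h)
  refine Ideal.isCoprime_iff_exists.2
    ⟨toB lb a, mem_ker_toLeaf.2 ha, toB lb b, mem_ker_toLeaf.2 hb, ?_⟩
  rw [← map_add, hab, map_one]

theorem iInf_ker_toLeaf (hlb : IsFine lb) :
    ⨅ e, RingHom.ker (toLeaf lb e) = Ideal.span {hB lb} := by
  ext b
  obtain ⟨p, rfl⟩ := toB_surjective lb b
  rw [toB_mem_span_iff, ← iInf_leafIdeal hlb, Ideal.mem_iInf, Ideal.mem_iInf]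
  exact forall_congr' fun e => mem_ker_toLeaf

/-- The coordinate ring of `C_e` is a polynomial ring. -/
def leafEquiv (hlb : IsFine lb) (e : Leaves T) : ℂ[X] ≃+* (LeafRing lb e) :=
  RingEquiv.ofBijective (leafCoord lb e) (leafCoord_bijective hlb e)

theorem isDomain_leaf (hlb : IsFine lb) (e : Leaves T) : IsDomain (LeafRing lb e) :=
  (leafEquiv hlb e).symm.toMulEquiv.isDomain ℂ[X]

theorem isPrincipalIdealRing_leaf (hlb : IsFine lb) (e : Leaves T) :
    IsPrincipalIdealRing (LeafRing lb e) :=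
  IsPrincipalIdealRing.of_surjective (leafEquiv hlb e).toRingHom (leafEquiv hlb e).surjective

theorem isRegularLocalRing_B (hlb : IsFine lb) (p : Ideal (CoordRing lb)) [p.IsPrime] :
    IsRegularLocalRing (Localization.AtPrime p) := by
  classical
  have := isDomain_B hlb
  have := isDomain_leaf hlb
  have := isPrincipalIdealRing_leaf hlb
  by_cases hp : hB lb ∈ p
  · exact isRegularLocalRing_of_mem (hB_ne_zero hlb) toLeaf_surjective (isCoprime_ker_toLeaf hlb)
      (iInf_ker_toLeaf hlb) p hp
  · exact isRegularLocalRing_of_notMem (L := Ah[X]) p hp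

theorem isIntegrallyClosed_B (hlb : IsFine lb) : IsIntegrallyClosed (CoordRing lb) := by
  have := isDomain_B hlb
  have := isDomain_leaf hlb
  refine isIntegrallyClosed_of_isLocalization_away (L := Ah[X]) (hB_ne_zero hlb) ?_
  rw [← iInf_ker_toLeaf hlb]
  exact Ideal.isRadical_iInf _ fun e => (RingHom.ker_isPrime _).isRadical

theorem exists_isMax (T : RootedTree.{0}) [Fintype T] : ∃ e : T, IsMax e :=
  (Finite.exists_le_maximal (p := fun _ : T => True) (a := ⊥) trivial).imp
    fun _ h => fun _ hb => h.2.2 trivial hb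

instance nonempty_leaves : Nonempty (Leaves T) :=
  let ⟨e, he⟩ := exists_isMax T
  ⟨⟨e, he⟩⟩

/-- Heights are bounded separately for primes containing `h` and for primes of `B[1/h]`. The bound
is attained at a closed point of a leaf curve. -/
theorem ringKrullDim_B (hlb : IsFine lb) : ringKrullDim (CoordRing lb) = 2 := by
  classical
  have := isDomain_B hlb
  have := isDomain_leaf hlb
  have := isPrincipalIdealRing_leaf hlb
  apply le_antisymm
  · refine (ringKrullDim_le_iff_height_le _).2 fun p hp => ?_
    by_cases hp : hB lb ∈ p
    · exact WithBot.coe_le_coe.2 (height_le_two toLeaf_surjective (isCoprime_ker_toLeaf hlb)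
        (iInf_ker_toLeaf hlb) p hp)
    · exact (height_le_ringKrullDim_away (L := Ah[X]) p hp).trans ringKrullDim_Ah_polynomial_le
  · obtain ⟨e⟩ : Nonempty (Leaves T) := inferInstance
    let θ : CoordRing lb →+* ℂ[X] := (leafEquiv hlb e).symm.toRingHom.comp (toLeaf lb e)
    have hθ : Function.Surjective θ := (leafEquiv hlb e).symm.surjective.comp (toLeaf_surjective e)
    have hker : RingHom.ker θ = RingHom.ker (toLeaf lb e) := by
      ext b
      simp [θ, RingHom.mem_ker]
    -- The origin of the line `C_e`, one step above the ideal of `C_e`.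
    let p := (Ideal.span {(Polynomial.X : ℂ[X])}).comap θ
    have hprime : (Ideal.span {(Polynomial.X : ℂ[X])}).IsPrime :=
      (Ideal.span_singleton_prime Polynomial.X_ne_zero).2 Polynomial.prime_X
    have hlt : RingHom.ker (toLeaf lb e) < p := by
      rw [← hker]
      refine lt_of_le_of_ne (Ideal.comap_mono bot_le) fun h => ?_
      have h1 : (⊥ : Ideal ℂ[X]) = Ideal.span {Polynomial.X} :=
        Ideal.comap_injective_of_surjective θ hθ h
      rw [eq_comm, Ideal.span_singleton_eq_bot] at h1
      exact Polynomial.X_ne_zero h1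
    exact le_trans (WithBot.coe_le_coe.2 (two_le_height (hB_ne_zero hlb) (iInf_ker_toLeaf hlb) hlt))
      Ideal.height_le_ringKrullDim_of_isPrime

/-- The fiber of `B` over `h = 0` is the product of the coordinate rings of the curves `C_e`. -/
def toLeaves (lb : T → ℂ) : CoordRing lb →+* ∀ e : Leaves T, LeafRing lb e :=
  RingHom.pi (toLeaf lb)

theorem ker_toLeaves (hlb : IsFine lb) : RingHom.ker (toLeaves lb) = Ideal.span {hB lb} := by
  rw [← iInf_ker_toLeaf hlb]
  ext b
  simp [toLeaves, RingHom.mem_ker, funext_iff]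

/-- The Chinese remainder theorem for the comaximal kernels. -/
theorem toLeaves_surjective (hlb : IsFine lb) : Function.Surjective (toLeaves lb) := by
  intro y
  choose b hb using fun e => toLeaf_surjective (lb := lb) e (y e)
  obtain ⟨c, hc⟩ := Ideal.pi_quotient_surjective (isCoprime_ker_toLeaf hlb)
    fun e => Ideal.Quotient.mk (RingHom.ker (toLeaf lb e)) (b e)
  refine ⟨c, funext fun e => ?_⟩
  have := Ideal.Quotient.eq.1 (hc e)
  rw [RingHom.mem_ker, map_sub, sub_eq_zero, hb] at this
  exact this

end CoordinateRing

/-! ### From the coordinate ring to the scheme and its fibers -/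

section Surface

variable {T : RootedTree.{0}} [Fintype T] (lb : T → ℂ)

/-! ### The trivial line bundle over the punctured line -/

/-- The morphism `Spec ℂ[h, h⁻¹] ⟶ Z`. -/
def specAhι : Spec (CommRingCat.of Ah) ⟶ Z :=
  Spec.map (CommRingCat.ofHom (algebraMap ℂ[X] Ah))

instance isOpenImmersion_specAhι : IsOpenImmersion specAhι :=
  inferInstanceAs (IsOpenImmersion (Spec.map (CommRingCat.ofHom
    (algebraMap ℂ[X] (Localization.Away (Polynomial.X : ℂ[X]))))))

theorem range_specAhι : Set.range specAhι = Set.range Zstar.ι := by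
  rw [Scheme.Opens.range_ι]
  exact PrimeSpectrum.localization_away_comap_range Ah (Polynomial.X : ℂ[X])

/-- The punctured line is the spectrum of `ℂ[h, h⁻¹]`. -/
def zstarIso : Zstar.toScheme ≅ Spec (CommRingCat.of Ah) :=
  IsOpenImmersion.isoOfRangeEq Zstar.ι specAhι range_specAhι.symm

theorem zstarIso_hom_fac : zstarIso.hom ≫ specAhι = Zstar.ι :=
  IsOpenImmersion.isoOfRangeEq_hom_fac _ _ _

/-- The morphism from the surface to the affine line. -/
def projZ : Spec (CommRingCat.of (CoordRing lb)) ⟶ Z :=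
  Spec.map (CommRingCat.ofHom (algebraMap ℂ[X] (CoordRing lb)))

theorem isPullback_specL : IsPullback
    (Spec.map (CommRingCat.ofHom (algebraMap (CoordRing lb) Ah[X])))
    (Spec.map (CommRingCat.ofHom (algebraMap Ah Ah[X]))) (projZ lb) specAhι := by
  have h : IsLocalization (Algebra.algebraMapSubmonoid (CoordRing lb)
      (Submonoid.powers (Polynomial.X : ℂ[X]))) Ah[X] := by
    rw [Algebra.algebraMapSubmonoid_powers]
    exact isLocalization_L lb
  have h2 : Algebra.IsPushout ℂ[X] (CoordRing lb) Ah Ah[X] :=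
    Algebra.isPushout_of_isLocalization (Submonoid.powers (Polynomial.X : ℂ[X])) _ _ _
  exact isPullback_SpecMap_of_isPushout _ _ _ _ (CommRingCat.isPushout_of_isPushout _ _ _ _)

/-- The affine line over the punctured line is the spectrum of `ℂ[h, h⁻¹][X₀]`. -/
def affineLineIso : 𝔸(PUnit; Zstar.toScheme) ≅ Spec (CommRingCat.of Ah[X]) :=
  (AffineSpace.functor.obj (Opposite.op PUnit)).mapIso zstarIso ≪≫
    AffineSpace.SpecIso PUnit (CommRingCat.of Ah) ≪≫
      Scheme.Spec.mapIso
        (MvPolynomial.uniqueAlgEquiv Ah PUnit).symm.toRingEquiv.toCommRingCatIso.op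

theorem affineLineIso_hom_over :
    affineLineIso.hom ≫ Spec.map (CommRingCat.ofHom (algebraMap Ah Ah[X])) =
      (𝔸(PUnit; Zstar.toScheme) ↘ Zstar.toScheme) ≫ zstarIso.hom := by
  have h1 : (MvPolynomial.uniqueAlgEquiv Ah PUnit).symm.toRingEquiv.toRingHom.comp
      (algebraMap Ah Ah[X]) = MvPolynomial.C :=
    RingHom.ext fun a => (MvPolynomial.uniqueAlgEquiv Ah PUnit).symm.commutes a
  have h2 : Spec.map (CommRingCat.ofHom
      (MvPolynomial.uniqueAlgEquiv Ah PUnit).symm.toRingEquiv.toRingHom) ≫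
      Spec.map (CommRingCat.ofHom (algebraMap Ah Ah[X])) =
        (AffineSpace.SpecIso PUnit (CommRingCat.of Ah)).inv ≫
          (𝔸(PUnit; Spec (CommRingCat.of Ah)) ↘ Spec (CommRingCat.of Ah)) := by
    rw [← Spec.map_comp, ← CommRingCat.ofHom_comp, h1, AffineSpace.SpecIso_inv_over]
  rw [← AffineSpace.map_over, ← Iso.hom_inv_id_assoc (AffineSpace.SpecIso PUnit _)
    (𝔸(PUnit; Spec (CommRingCat.of Ah)) ↘ Spec (CommRingCat.of Ah)), ← h2]
  rfl

theorem isPullback_affineLine : IsPullback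
    (affineLineIso.hom ≫ Spec.map (CommRingCat.ofHom (algebraMap (CoordRing lb) Ah[X])))
    (𝔸(PUnit; Zstar.toScheme) ↘ Zstar.toScheme) (projZ lb) Zstar.ι := by
  rw [← zstarIso_hom_fac]
  exact (IsPullback.of_horiz_isIso ⟨affineLineIso_hom_over⟩).paste_horiz (isPullback_specL lb)

theorem isTrivialLineBundleOver_projZ : IsTrivialLineBundleOver (projZ lb) Zstar :=
  ⟨(isPullback_morphismRestrict (projZ lb) Zstar).flip.isoIsPullback _ _ (isPullback_affineLine lb),
    IsPullback.isoIsPullback_hom_snd _ _ (isPullback_morphismRestrict (projZ lb) Zstar).flip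
      (isPullback_affineLine lb)⟩

/-! ### Fibers -/

/-- The trivial line bundle over the punctured line is pulled back along the point `z`. This serves
both the generic fiber and the closed fibers away from the origin. -/
theorem exists_fiber_iso_of_mem_Zstar {z : Z} (hz : z ∈ Zstar) :
    ∃ i : (projZ lb).fiber z ≅ 𝔸(PUnit; Spec (Z.residueField z)),
      i.hom ≫ (𝔸(PUnit; Spec (Z.residueField z)) ↘ Spec (Z.residueField z)) =
        (projZ lb).fiberToSpecResidueField z := by
  let g : Spec (Z.residueField z) ⟶ Zstar.toScheme :=
    IsOpenImmersion.lift Zstar.ι (Z.fromSpecResidueField z) (by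
      rw [Scheme.range_fromSpecResidueField, Scheme.Opens.range_ι]
      simpa using hz)
  have hg : g ≫ Zstar.ι = Z.fromSpecResidueField z := IsOpenImmersion.lift_fac _ _ _
  have h := (AffineSpace.isPullback_map (n := PUnit) g).paste_horiz (isPullback_affineLine lb)
  rw [hg] at h
  exact ⟨(IsPullback.of_hasPullback (projZ lb) (Z.fromSpecResidueField z)).isoIsPullback _ _ h,
    IsPullback.isoIsPullback_hom_snd _ _ (IsPullback.of_hasPullback _ _) h⟩

theorem isIntegral_fiber_of_mem_Zstar {z : Z} (hz : z ∈ Zstar) :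
    IsIntegral ((projZ lb).fiber z) := by
  obtain ⟨i, -⟩ := exists_fiber_iso_of_mem_Zstar lb hz
  have : Nonempty ((projZ lb).fiber z) := ⟨i.inv (Classical.arbitrary _)⟩
  exact isIntegral_of_isOpenImmersion i.hom

theorem liftOfSurjective_apply {R S P : Type*} [CommRing R] [CommRing S] [CommRing P] (f : R →+* S)
    (hf : Function.Surjective f) (g : {g : R →+* P // RingHom.ker f ≤ RingHom.ker g}) (x : R) :
    f.liftOfSurjective hf g (f x) = g.1 x :=
  RingHom.liftOfRightInverse_comp_apply f _ (Function.rightInverse_surjInv hf) g x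

/-- With `R' = R / J`, the pushout is `S / J S`; the condition `hker` says that `k` kills no more
than `J S`. -/
theorem isPushout_of_surjective {R S R' S' : CommRingCat.{0}} {f : R ⟶ S} {g : R ⟶ R'}
    {k : S ⟶ S'} {t : R' ⟶ S'} (hg : Function.Surjective g.hom) (hk : Function.Surjective k.hom)
    (hker : RingHom.ker k.hom ≤ (RingHom.ker g.hom).map f.hom) (w : f ≫ k = g ≫ t) :
    IsPushout f g k t := by
  have hw (r : R) : k.hom (f.hom r) = t.hom (g.hom r) := congr($w r)
  refine ⟨⟨w⟩, ⟨PushoutCocone.IsColimit.mk _ (fun s => CommRingCat.ofHom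
    (RingHom.liftOfSurjective k.hom hk ⟨s.inl.hom,
      hker.trans (Ideal.map_le_iff_le_comap.2 ?_)⟩)) ?_ ?_ ?_⟩⟩
  · intro r hr
    have h : s.inl.hom (f.hom r) = s.inr.hom (g.hom r) := congr($(s.condition) r)
    rwa [(hr : g.hom r = 0), map_zero] at h
  · intro s
    exact CommRingCat.hom_ext (RingHom.ext fun x => liftOfSurjective_apply _ hk _ x)
  · intro s
    refine CommRingCat.hom_ext (RingHom.ext fun x => ?_)
    obtain ⟨r, rfl⟩ := hg x
    have h : s.inl.hom (f.hom r) = s.inr.hom (g.hom r) := congr($(s.condition) r)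
    rw [← h, CommRingCat.hom_comp, RingHom.comp_apply, ← hw]
    exact liftOfSurjective_apply _ hk _ _
  · intro s m hm _
    refine CommRingCat.hom_ext (RingHom.ext fun x => ?_)
    obtain ⟨y, rfl⟩ := hk x
    have h : m.hom (k.hom y) = s.inl.hom y := congr($hm y)
    rw [h, CommRingCat.hom_ofHom, liftOfSurjective_apply]

/-- The fiber of an affine morphism over a closed point, in terms of a surjection of rings. -/
theorem exists_isPullback_fromSpecResidueField {R S S' : CommRingCat.{0}} (x : Spec R)
    [x.asIdeal.IsMaximal] (f : R ⟶ S) (k : S ⟶ S') (hk : Function.Surjective k.hom)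
    (hker : RingHom.ker k.hom = x.asIdeal.map f.hom) :
    ∃ t, IsPullback (Spec.map k) t (Spec.map f) ((Spec R).fromSpecResidueField x) := by
  let g : R ⟶ CommRingCat.of x.asIdeal.ResidueField :=
    CommRingCat.ofHom (algebraMap R x.asIdeal.ResidueField)
  have hg : Function.Surjective g.hom := Ideal.algebraMap_residueField_surjective _
  have hkerg : RingHom.ker g.hom = x.asIdeal := Ideal.ker_algebraMap_residueField _
  let t : CommRingCat.of x.asIdeal.ResidueField ⟶ S' := CommRingCat.ofHom
    (RingHom.liftOfSurjective g.hom hg ⟨k.hom.comp f.hom, by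
      rw [hkerg, ← RingHom.comap_ker, hker]
      exact Ideal.le_comap_map⟩)
  have hw : f ≫ k = g ≫ t := by
    refine CommRingCat.hom_ext (RingHom.ext fun r => ?_)
    rw [CommRingCat.hom_comp g t, RingHom.comp_apply, CommRingCat.hom_ofHom,
      liftOfSurjective_apply]
    rfl
  have h := isPullback_SpecMap_of_isPushout _ _ _ _
    (isPushout_of_surjective hg hk (by rw [hker, hkerg]) hw)
  refine ⟨Spec.map t ≫ Spec.map (Scheme.Spec.residueFieldIso R x).hom, ?_⟩
  refine h.of_iso (Iso.refl _) (Iso.refl _)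
    (Scheme.Spec.mapIso (Scheme.Spec.residueFieldIso R x).op) (Iso.refl _) ?_ ?_ ?_ ?_
  · simp
  · exact (Category.id_comp _).symm
  · simp
  · rw [← Scheme.Spec.map_residueFieldIso_inv_eq_fromSpecResidueField, Iso.refl_hom,
      Category.comp_id]
    have h1 : Spec.map (Scheme.Spec.residueFieldIso R x).hom ≫
        Spec.map (Scheme.Spec.residueFieldIso R x).inv = 𝟙 _ := by
      rw [← Spec.map_comp, Iso.inv_hom_id, Spec.map_id]
    exact ((Category.assoc _ _ _).symm.trans
      ((congrArg (· ≫ Spec.map g) h1).trans (Category.id_comp _))).symm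

theorem isMaximal_z₀ : (PrimeSpectrum.asIdeal z₀).IsMaximal :=
  PrincipalIdealRing.isMaximal_of_irreducible Polynomial.irreducible_X

theorem exists_isPullback_leaves (hlb : IsFine lb) : ∃ t,
    IsPullback (Spec.map (CommRingCat.ofHom (toLeaves lb))) t (projZ lb)
      (Z.fromSpecResidueField z₀) := by
  have : (PrimeSpectrum.asIdeal z₀).IsMaximal := isMaximal_z₀
  refine exists_isPullback_fromSpecResidueField (R := CommRingCat.of ℂ[X])
    (S := CommRingCat.of (CoordRing lb)) z₀ _ (CommRingCat.ofHom (toLeaves lb))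
    (toLeaves_surjective hlb) ?_
  refine (ker_toLeaves hlb).trans ?_
  change _ = Ideal.map (algebraMap ℂ[X] (CoordRing lb)) (Ideal.span {(Polynomial.X : ℂ[X])})
  rw [Ideal.map_span, Set.image_singleton]

/-- The union of the curves `C_e` is the fiber over the origin. -/
theorem exists_iso_fiber_z₀ (hlb : IsFine lb) :
    ∃ i : Spec (CommRingCat.of (∀ e : Leaves T, LeafRing lb e)) ≅ (projZ lb).fiber z₀,
      i.hom ≫ (projZ lb).fiberι z₀ = Spec.map (CommRingCat.ofHom (toLeaves lb)) := by
  obtain ⟨t, h⟩ := exists_isPullback_leaves lb hlb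
  exact ⟨h.isoIsPullback _ _ (IsPullback.of_hasPullback (projZ lb) (Z.fromSpecResidueField z₀)),
    IsPullback.isoIsPullback_hom_fst _ _ h (IsPullback.of_hasPullback _ _)⟩

theorem exists_iso_fiber_leafCurve (hlb : IsFine lb) :
    ∃ i : (∐ fun e : Leaves T => Spec (CommRingCat.of (LeafRing lb e))) ≅ (projZ lb).fiber z₀,
      ∀ e : Leaves T, Sigma.ι (fun e : Leaves T => Spec (CommRingCat.of (LeafRing lb e))) e ≫
        i.hom ≫ (projZ lb).fiberι z₀ = Spec.map (CommRingCat.ofHom (toLeaf lb e)) := by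
  obtain ⟨i, hi⟩ := exists_iso_fiber_z₀ lb hlb
  -- The spectrum of a finite product is the disjoint union of the spectra.
  refine ⟨asIso (sigmaSpec fun e : Leaves T => CommRingCat.of (LeafRing lb e)) ≪≫ i, fun e => ?_⟩
  rw [Iso.trans_hom, Category.assoc, hi, asIso_hom, ι_sigmaSpec_assoc, ← Spec.map_comp]
  rfl

/-! ### Local and global properties -/

/-- The stalk of an affine scheme is the localization at a prime ideal. -/
def stalkEquiv (R : Type) [CommRing R] (x : PrimeSpectrum R) :
    Localization.AtPrime x.asIdeal ≃+* (Spec (CommRingCat.of R)).presheaf.stalk x :=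
  (Spec.stalkIso (CommRingCat.of R) x).symm.commRingCatIsoToRingEquiv

theorem isNonsingular_Spec_B (hlb : IsFine lb) :
    IsNonsingular (Spec (CommRingCat.of (CoordRing lb))) := fun (x : PrimeSpectrum _) => by
  have := isRegularLocalRing_B hlb x.asIdeal
  exact IsRegularLocalRing.of_ringEquiv (stalkEquiv _ x)

theorem isIntegral_Spec_B (hlb : IsFine lb) : IsIntegral (Spec (CommRingCat.of (CoordRing lb))) := by
  have : IsDomain (CommRingCat.of (CoordRing lb)) := isDomain_B hlb
  infer_instance

theorem isIntegrallyClosed_stalk (hlb : IsFine lb) (x : PrimeSpectrum (CoordRing lb)) :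
    IsIntegrallyClosed ((Spec (CommRingCat.of (CoordRing lb))).presheaf.stalk x) := by
  have := isDomain_B hlb
  have := isIntegrallyClosed_B hlb
  have : IsIntegrallyClosed (Localization.AtPrime x.asIdeal) :=
    isIntegrallyClosed_of_isLocalization _ x.asIdeal.primeCompl
      x.asIdeal.primeCompl_le_nonZeroDivisors
  exact IsIntegrallyClosed.of_equiv (stalkEquiv _ x)

theorem locallyOfFiniteType_projZ : LocallyOfFiniteType (projZ lb) := by
  refine (HasRingHomProperty.Spec_iff (P := @LocallyOfFiniteType)).2 ?_
  exact RingHom.finiteType_algebraMap.2 (inferInstanceAs (Algebra.FiniteType ℂ[X] (B lb)))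

theorem flat_projZ (hlb : IsFine lb) : Flat (projZ lb) := by
  refine (HasRingHomProperty.Spec_iff (P := @Flat)).2 ?_
  exact RingHom.flat_algebraMap_iff.2 (flat_B hlb)

theorem nonempty_fiber (hlb : IsFine lb) (z : Z) : Nonempty ((projZ lb).fiber z) := by
  by_cases hz : z ∈ Zstar
  · have := isIntegral_fiber_of_mem_Zstar lb hz
    infer_instance
  · obtain rfl : z = z₀ := by simpa [mem_Zstar_iff] using hz
    obtain ⟨i, -⟩ := exists_iso_fiber_z₀ lb hlb
    have (e : Leaves T) : Nontrivial (LeafRing lb e) := (isDomain_leaf hlb e).toNontrivial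
    have : Nontrivial (CommRingCat.of (∀ e : Leaves T, LeafRing lb e)) :=
      Pi.nontrivial_at (f := LeafRing lb) (Classical.arbitrary _)
    exact ⟨i.hom (Classical.arbitrary (PrimeSpectrum _))⟩

theorem surjective_projZ (hlb : IsFine lb) : Surjective (projZ lb) := by
  refine ⟨fun z => ?_⟩
  obtain ⟨x⟩ := nonempty_fiber lb hlb z
  have h : (projZ lb).fiberι z x ∈ Set.range ((projZ lb).fiberι z) := ⟨x, rfl⟩
  rw [Scheme.Hom.range_fiberι] at h
  exact ⟨_, h⟩

theorem isReduced_fiber (hlb : IsFine lb) (z : Z) : IsReduced ((projZ lb).fiber z) := by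
  by_cases hz : z ∈ Zstar
  · have := isIntegral_fiber_of_mem_Zstar lb hz
    infer_instance
  · obtain rfl : z = z₀ := by simpa [mem_Zstar_iff] using hz
    obtain ⟨i, -⟩ := exists_iso_fiber_z₀ lb hlb
    have := isDomain_leaf hlb
    have : _root_.IsReduced (CommRingCat.of (∀ e : Leaves T, LeafRing lb e)) :=
      inferInstanceAs (_root_.IsReduced (∀ e : Leaves T, LeafRing lb e))
    exact isReduced_of_isOpenImmersion i.inv

theorem genericPoint_mem_Zstar : genericPoint Z ∈ Zstar := by
  refine ((genericPoint_spec Z).mem_open_set_iff Zstar.isOpen).2 ?_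
  refine ⟨(⟨⊥, Ideal.isPrime_bot⟩ : PrimeSpectrum ℂ[X]), trivial, ?_⟩
  exact fun h => Polynomial.X_ne_zero ((Ideal.mem_bot).1 h)

theorem isGDS_projZ (hlb : IsFine lb) : IsGDS (projZ lb) where
  isAffine := inferInstance
  locallyOfFiniteType := locallyOfFiniteType_projZ lb
  isIntegral := isIntegral_Spec_B lb hlb
  dim_eq_two := (PrimeSpectrum.topologicalKrullDim_eq_ringKrullDim _).trans (ringKrullDim_B hlb)
  normal := isIntegrallyClosed_stalk lb hlb
  flat := flat_projZ lb hlb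
  surjective := surjective_projZ lb hlb
  reduced_fiber := isReduced_fiber lb hlb
  generic_fiber := exists_fiber_iso_of_mem_Zstar lb genericPoint_mem_Zstar
  integral_fiber := ⟨z₀, (PrimeSpectrum.isClosed_singleton_iff_isMaximal _).2 isMaximal_z₀,
    fun z _ hz => isIntegral_fiber_of_mem_Zstar lb ((mem_Zstar_iff z).2 hz)⟩

end Surface

end GDS

end

theorem theorem1p1 (T : RootedTree.{0}) [Fintype T] (lb : T → ℂ) (hlb : GDS.IsFine lb) :
    GDS.IsGDS (GDS.q lb) ∧
    GDS.IsTrivialLineBundleOver (GDS.q lb) GDS.Zstar ∧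
    (∃ i : (∐ fun e : GDS.Leaves T => GDS.leafCurve lb e) ≅ (GDS.q lb).fiber GDS.z₀,
      ∀ e : GDS.Leaves T,
        Sigma.ι (fun e : GDS.Leaves T => GDS.leafCurve lb e) e ≫ i.hom ≫
          (GDS.q lb).fiberι GDS.z₀ = GDS.leafCurveι lb e) ∧
    (∀ e : GDS.Leaves T, Function.Bijective (GDS.leafCoord lb e)) ∧
    GDS.IsNonsingular (GDS.V lb) :=
  -- `CoordRing` and `LeafRing` unfold to the original quotients, so `projZ` is `q` and `toLeaf`
  -- induces `leafCurveι` by definition.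
  ⟨GDS.isGDS_projZ lb hlb, GDS.isTrivialLineBundleOver_projZ lb,
    GDS.exists_iso_fiber_leafCurve lb hlb, GDS.leafCoord_bijective hlb,
    GDS.isNonsingular_Spec_B lb hlb⟩
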